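/- Let $\mathcal M$ be a continuous-time Markov decision process with finite sets $L$ of locations and $Act$ of actions, rates $R(l,a,l')\ge 0$, an absorbing goal region $G\subseteq L$ (that is, $R(l,a,l')=0$ for $l\in G$, $l'\notin G$), and an initial distribution $\nu$ on $L$, such that for every location $l$ the set $Act(l)$ of enabled actions (those $a$ with $R(l,a,L)=\sum_{l'}R(l,a,l')>0$) is nonempty. Let $t_{\max}\ge 0$. A timed history-dependent randomised (THR) scheduler maps a timed path $\pi=l_0\xrightarrow{a_0,t_0}l_1\cdots\xrightarrow{a_{n-1},t_{n-1}}l_n$ (with $0\le t_0\le\cdots\le t_{n-1}\le t_{\max}$) and a time $t$ to a probability distribution on $Act(l_n)$; under it, in history $\pi$ at time $t$, a transition to $l'$ with action $a$ is taken at rate $\mathcal S(\pi,t)(a)\,R(l_n,a,l')$. It is cylindrical if, for some partition of $[0,t_{\max}]$ into finitely many intervals $[0,t_0],(t_0,t_1],\dots$, it depends only on the locations and actions of $\pi$ and on the intervals containing the times of $\pi$ and $t$. For a cylindrical scheduler, $Pr_{\mathcal S}(l,t)$ is the probability of visiting $G$ up to time $t_{\max}$ when starting in $l$ at time $t$ (with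 the one-location history $l$). The distance of two cylindrical schedulers $D,E$ is the probability that, starting from $\nu$ at time $0$, the following difference process reaches a fresh absorbing location $g$ up to time $t_{\max}$: on every history it chooses each action $a$ with the minimum of the probabilities $p_D(a)$, $p_E(a)$ given to it by $D$ and $E$; with the remaining probability it chooses a fresh action that leads only to $g$, with rate $R(l,a_D,L)+R(l,a_E,L)$, where $a_D$ has maximal exit rate $R(l,\cdot,L)$ among the actions with $p_D>p_E$, and $a_E$ among those with $p_E>p_D$. A measurable THR scheduler $\mathcal S$ is (represented by) a Cauchy sequence $(\mathcal S_n)$ of cylindrical THR schedulers for this distance, and $Pr_{\mathcal S}(l,t)=\lim_n Pr_{\mathcal S_n}(l,t)$, $Pr_{\mathcal S}(t_{\max})=\lim_n\sum_l\nu(l)Pr_{\mathcal S_n}(l,0)$. For $\mathsf{opt}\in\{\max,\min\}$ let $f_{\mathsf{opt}}:L\times[0,t_{\max}]\to\mathbb R$ solve $$-\dot f_{\mathsf{opt}}(l,t)=\mathop{\mathsf{opt}}_{a\in Act(l)}\sum_{l'\in L}R(l,a,l')\bigl(f_{\mathsf{opt}}(l',t)-f_{\mathsf{opt}}(l,t)\bigr)\qquad(l\in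 L,\ t\in[0,t_{\max}])$$ (with one-sided derivatives at the end points), with $f_{\mathsf{opt}}(l,t)=1$ for $l\in G$, $t\in[0,t_{\max}]$, and $f_{\mathsf{opt}}(l,t_{\max})=0$ for $l\notin G$. Then for every measurable THR scheduler $\mathcal S$, every $l\in L$ and every $t\in[0,t_{\max}]$, $$f_{\min}(l,t)\le Pr_{\mathcal S}(l,t)\le f_{\max}(l,t)$$ whenever the limit $Pr_{\mathcal S}(l,t)$ exists, and it does exist whenever $\nu(l)>0$. Moreover $Pr_{\mathcal S}(t_{\max})$ exists and $$\sum_{l}\nu(l)f_{\min}(l,0)\le Pr_{\mathcal S}(t_{\max})\le\sum_{l}\nu(l)f_{\max}(l,0).$$ -/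

import Mathlib

open MeasureTheory Filter Topology
open scoped NNReal ENNReal

/-- A (traditional, late-scheduling) continuous-time Markov decision process over finitely many
locations `L` and actions `Act`: only continuous locations, one player. The jump probabilities
`P(l,a,l') = R(l,a,l') / R(l,a,L)` are determined by the rates. -/
structure CTMDP (L Act : Type*) [Fintype L] [Fintype Act] where
  /-- the rate matrix `R(l,a,l')` -/
  rate : L → Act → L → ℝ≥0
  /-- the goal region `G` -/
  goal : Set L
  /-- the initial distribution `ν` -/
  init : L → ℝ≥0
  init_sum : ∑ l, init l = 1
  /-- every location has an enabled action, i.e. an action with positive exit rate -/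
  exists_enabled : ∀ l, ∃ a, 0 < ∑ l', rate l a l'
  /-- the goal region is absorbing -/
  absorbing : ∀ l ∈ goal, ∀ a, ∀ l' ∉ goal, rate l a l' = 0

/-- Timed paths `l₀ --(a₀,t₀)--> l₁ --(a₁,t₁)--> ⋯ lₙ`, where `tᵢ` is the system time at which
the transition from `lᵢ` to `lᵢ₊₁` is taken. -/
inductive TimedPath (L Act : Type*) where
  | start (l : L) : TimedPath L Act
  | step (π : TimedPath L Act) (a : Act) (t : ℝ) (l : L) : TimedPath L Act

namespace TimedPath

variable {L Act : Type*}

/-- The last location of a path. -/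
def last : TimedPath L Act → L
  | start l => l
  | step _ _ _ l => l

/-- The time of the last transition (`0` if there is none). -/
def clock : TimedPath L Act → ℝ
  | start _ => 0
  | step _ _ t _ => t

/-- The times are ordered, and they lie in `[0, T]`. -/
def IsTimed (T : ℝ) : TimedPath L Act → Prop
  | start _ => True
  | step π _ t _ => π.IsTimed T ∧ π.clock ≤ t ∧ t ≤ T

/-- The path contains a location from `G`. -/
def Visits (G : Set L) : TimedPath L Act → Prop
  | start l => l ∈ G
  | step π _ _ l => π.Visits G ∨ l ∈ G

end TimedPath

/-- For a finite set `J = {t₀ < ⋯ < tₙ = T}` of endpoints, the times `s, t ∈ [0, T]` lie in the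
same interval of the partition `[0,t₀], (t₀,t₁], …, (tₙ₋₁,tₙ]`. -/
def SameCell (J : Finset ℝ) (s t : ℝ) : Prop :=
  ∀ c ∈ J, (s ≤ c ↔ t ≤ c)

/-- Two timed paths have the same cylindrification with respect to the partition given by `J`. -/
def TimedPath.SameCylinder {L Act : Type*} (J : Finset ℝ) :
    TimedPath L Act → TimedPath L Act → Prop
  | .start l, .start l' => l = l'
  | .step π a t l, .step π' a' t' l' =>
      TimedPath.SameCylinder J π π' ∧ a = a' ∧ SameCell J t t' ∧ l = l'
  | _, _ => False

namespace CTMDP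

variable {L Act : Type*} [Fintype L] [Fintype Act]

/-- The exit rate `R(l,a,L)`. -/
def exitRate (M : CTMDP L Act) (l : L) (a : Act) : ℝ≥0 := ∑ l', M.rate l a l'

open Classical in
/-- The set `Act(l)` of enabled actions. -/
noncomputable def enabled (M : CTMDP L Act) (l : L) : Finset Act :=
  Finset.univ.filter fun a => 0 < M.exitRate l a

theorem mem_enabled {M : CTMDP L Act} {l : L} {a : Act} :
    a ∈ M.enabled l ↔ 0 < M.exitRate l a := by
  rw [enabled, Finset.mem_filter]
  exact and_iff_right (Finset.mem_univ a)

theorem enabled_nonempty (M : CTMDP L Act) (l : L) : (M.enabled l).Nonempty := by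
  obtain ⟨a, ha⟩ := M.exists_enabled l
  exact ⟨a, mem_enabled.2 ha⟩

/-! ### The differential equations for `f_max` and `f_min` -/

/-- `∑_{l'} R(l,a,l') (v(l') - v(l))`. -/
def drift (M : CTMDP L Act) (v : L → ℝ) (l : L) (a : Act) : ℝ :=
  ∑ l', (M.rate l a l' : ℝ) * (v l' - v l)

/-- `f(l,t) = 1` for goal locations and `t ≤ T`, `f(l,T) = 0` for the other locations. -/
def BoundaryConditions (M : CTMDP L Act) (T : ℝ) (f : L → ℝ → ℝ) : Prop :=
  (∀ l ∈ M.goal, ∀ t ∈ Set.Icc 0 T, f l t = 1) ∧ ∀ l ∉ M.goal, f l T = 0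

/-- `f = f_max`: on `[0, T]` (with one-sided derivatives at the end points)
`-f'(l,t) = max_{a ∈ Act(l)} ∑_{l'} R(l,a,l') (f(l',t) - f(l,t))`. -/
def IsFMax (M : CTMDP L Act) (T : ℝ) (f : L → ℝ → ℝ) : Prop :=
  M.BoundaryConditions T f ∧ ∀ l, ∀ t ∈ Set.Icc 0 T,
    HasDerivWithinAt (f l)
      (-(M.enabled l).sup' (M.enabled_nonempty l) (M.drift (fun l' => f l' t) l))
      (Set.Icc 0 T) t

/-- `f = f_min`: on `[0, T]` (with one-sided derivatives at the end points)
`-f'(l,t) = min_{a ∈ Act(l)} ∑_{l'} R(l,a,l') (f(l',t) - f(l,t))`. -/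
def IsFMin (M : CTMDP L Act) (T : ℝ) (f : L → ℝ → ℝ) : Prop :=
  M.BoundaryConditions T f ∧ ∀ l, ∀ t ∈ Set.Icc 0 T,
    HasDerivWithinAt (f l)
      (-(M.enabled l).inf' (M.enabled_nonempty l) (M.drift (fun l' => f l' t) l))
      (Set.Icc 0 T) t

/-! ### Schedulers and the law of the complete timed path -/

/-- A timed history-dependent randomised (THR) scheduler: it maps a timed path and the current
time to a distribution over the actions enabled in the last location of the path.
(Values at paths that are not ordered in time, or at negative times, are never used.) -/
structure Scheduler (M : CTMDP L Act) where
  prob : TimedPath L Act → ℝ → Act → ℝ≥0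
  sum_eq_one : ∀ π t, ∑ a, prob π t a = 1
  enabled_of_ne_zero : ∀ π t a, prob π t a ≠ 0 → a ∈ M.enabled π.last

namespace Scheduler

variable {M : CTMDP L Act}

/-- The scheduler is cylindrical: for some partition of `[0, T]` into finitely many intervals its
decisions depend only on the cylindrification of the path and of the time. -/
def IsCylindrical (S : M.Scheduler) (T : ℝ) : Prop :=
  ∃ J : Finset ℝ, (∀ c ∈ J, c ∈ Set.Icc 0 T) ∧ T ∈ J ∧
    ∀ π π' : TimedPath L Act, ∀ t ∈ Set.Icc 0 T, ∀ t' ∈ Set.Icc 0 T,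
      π.IsTimed T → π'.IsTimed T → TimedPath.SameCylinder J π π' → SameCell J t t' →
        S.prob π t = S.prob π' t'

/-- The expected exit rate `∑ₐ pₐ R(l,a,L)` at time `t` after the history `π` ending in `l`. -/
def exitRate (S : M.Scheduler) (π : TimedPath L Act) (t : ℝ) : ℝ≥0 :=
  ∑ a, S.prob π t a * M.exitRate π.last a

/-- The probability of not taking any transition in `(t, s]` after the history `π`. -/
noncomputable def survival (S : M.Scheduler) (π : TimedPath L Act) (t s : ℝ) : ℝ≥0∞ :=
  ENNReal.ofReal (Real.exp (-∫ u in t..s, (S.exitRate π u : ℝ)))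

/-- The law of the complete timed path. `S.pathProb T A n π t` is the probability that, if the
system is at time `t` with history `π`, then exactly `n` further transitions are taken
up to time `T` and the resulting complete path belongs to `A`. The `n` transitions are integrated
out one after the other: while the history is `π`, the transition with action `a` to `l'` is
taken at time `s` with rate `S(π,s)(a) * R(l,a,l')`. -/
noncomputable def pathProb (S : M.Scheduler) (T : ℝ) (A : Set (TimedPath L Act)) :
    ℕ → TimedPath L Act → ℝ → ℝ≥0∞
  | 0, π, t => A.indicator (fun _ => 1) π * S.survival π t T
  | n + 1, π, t => ∫⁻ s in Set.Ioc t T, S.survival π t s *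
      ∑ a, ∑ l', ((S.prob π s a * M.rate π.last a l' : ℝ≥0) : ℝ≥0∞) *
        S.pathProb T A n (π.step a s l') s

/-- `Pr_S(π,t)`: the probability that the complete path visits the goal region (up to time `T`),
if the system is at time `t` with history `π`; it is the limit over `n` of the probability to do
so on a path with at most `n` further transitions. -/
noncomputable def reachProbFrom (S : M.Scheduler) (T : ℝ) (π : TimedPath L Act) (t : ℝ) : ℝ :=
  (∑' n, S.pathProb T {ρ | ρ.Visits M.goal} n π t).toReal

/-- `Pr_S(l,t)`: the probability of reaching the goal region up to time `T`, when starting in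
location `l` at time `t`. -/
noncomputable def reachProb (S : M.Scheduler) (T : ℝ) (l : L) (t : ℝ) : ℝ :=
  S.reachProbFrom T (.start l) t

/-- `∑ₗ ν(l) Pr_S(l,0)`: the time-bounded reachability probability for the time bound `T`. -/
noncomputable def totalReachProb (S : M.Scheduler) (T : ℝ) : ℝ :=
  ∑ l, (M.init l : ℝ) * S.reachProb T l 0

end Scheduler

/-! ### The distance of two schedulers -/

/-- The actions of the difference process: the old actions `a`, the fresh actions `(a,b)`, and a
fresh action (`none`) that is the only enabled action of the fresh goal location. -/
abbrev DiffAct (Act : Type*) := Option (Act ⊕ Act × Act)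

/-- The rates of the difference process; `none : Option L` is the fresh goal location, entered by
the fresh action `(a,b)` with rate `R(l,a,L) + R(l,b,L)`. -/
def diffRate (M : CTMDP L Act) : Option L → DiffAct Act → Option L → ℝ≥0
  | some l, some (.inl a), some l' => M.rate l a l'
  | some l, some (.inr (a, b)), none => M.exitRate l a + M.exitRate l b
  | none, none, none => 1
  | _, _, _ => 0

/-- The difference process: its only goal location is the fresh one. -/
def diff (M : CTMDP L Act) : CTMDP (Option L) (DiffAct Act) where
  rate := M.diffRate
  goal := {none}
  init := fun x => x.elim 0 M.init
  init_sum := by simp [Fintype.sum_option, M.init_sum]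
  exists_enabled := by
    rintro (_ | l)
    · exact ⟨none, by simp [Fintype.sum_option, diffRate]⟩
    · obtain ⟨a, ha⟩ := M.exists_enabled l
      exact ⟨some (.inl a), by simpa [Fintype.sum_option, diffRate] using ha⟩
  absorbing := by
    rintro l rfl a (_ | l') h
    · simp at h
    · rcases a with _ | a | a <;> rfl

/-- The path of the original process underlying a path of the difference process that uses only
old locations and old actions. -/
def oldPath : TimedPath (Option L) (DiffAct Act) → Option (TimedPath L Act)
  | .start (some l) => some (.start l)
  | .step π (some (.inl a)) t (some l) => (oldPath π).map fun ρ => ρ.step a t l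
  | _ => none

open Classical in
/-- Among the actions with `p a > q a`, one with maximal exit rate from `l` (if there is any).
Ties can be broken arbitrarily, since only the exit rate of the chosen action matters. -/
noncomputable def surplusAction (M : CTMDP L Act) (l : L) (p q : Act → ℝ≥0) : Option Act :=
  if h : (Finset.univ.filter fun a => q a < p a).Nonempty then
    some (Finset.exists_max_image _ (M.exitRate l) h).choose
  else none

open Classical in
/-- The decision of the difference scheduler in `l`, if the two schedulers choose the
distributions `p` and `q`: an old action `a` with probability `min (p a) (q a)`, and with the
remaining probability a fresh action `(a,b)`, where `a` is a surplus action of `p` and `b` one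
of `q`. -/
noncomputable def diffDecision (M : CTMDP L Act) (l : L) (p q : Act → ℝ≥0) : DiffAct Act → ℝ≥0
  | none => 0
  | some (.inl a) => min (p a) (q a)
  | some (.inr (a, b)) =>
      if M.surplusAction l p q = some a ∧ M.surplusAction l q p = some b then
        1 - ∑ c, min (p c) (q c)
      else 0

theorem surplusAction_spec {M : CTMDP L Act} {l : L} {p q : Act → ℝ≥0} {a : Act}
    (h : M.surplusAction l p q = some a) : q a < p a := by
  classical
  unfold surplusAction at h
  split_ifs at h with hn
  have := (Finset.exists_max_image _ (M.exitRate l) hn).choose_spec.1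
  rw [Option.some.inj h] at this
  simpa using this

theorem eq_of_surplusAction_eq_none {M : CTMDP L Act} {l : L} {p q : Act → ℝ≥0}
    (hp : ∑ a, p a = 1) (hq : ∑ a, q a = 1) (h : M.surplusAction l p q = none) : p = q := by
  classical
  unfold surplusAction at h
  split_ifs at h with hn
  have hle : ∀ a ∈ Finset.univ, p a ≤ q a := by
    intro a _
    by_contra hlt
    exact hn ⟨a, by simpa using hlt⟩
  funext a
  exact (Finset.sum_eq_sum_iff_of_le hle).1 (hp.trans hq.symm) a (Finset.mem_univ a)

theorem sum_diffDecision {M : CTMDP L Act} {l : L} {p q : Act → ℝ≥0}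
    (hp : ∑ a, p a = 1) (hq : ∑ a, q a = 1) : ∑ x, M.diffDecision l p q x = 1 := by
  classical
  have hmin : ∑ c, min (p c) (q c) ≤ 1 := hp ▸ Finset.sum_le_sum fun c _ => min_le_left _ _
  simp only [Fintype.sum_option, Fintype.sum_sum_type, Fintype.sum_prod_type, diffDecision,
    zero_add]
  rcases h₁ : M.surplusAction l p q with _ | a
  · simp [eq_of_surplusAction_eq_none hp hq h₁, hq]
  rcases h₂ : M.surplusAction l q p with _ | b
  · simp [eq_of_surplusAction_eq_none hq hp h₂, hp]
  simp only [Option.some.injEq]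
  have key : ∀ r : ℝ≥0, ∑ x, ∑ y, (if a = x ∧ b = y then r else 0) = r := by
    intro r
    rw [Finset.sum_eq_single a, Finset.sum_eq_single b]
    · simp
    · intro y _ hy
      simp [hy.symm]
    · simp
    · intro x _ hx
      simp [hx.symm]
    · simp
  rw [key, add_tsub_cancel_of_le hmin]

theorem last_of_oldPath {L Act : Type*} {π : TimedPath (Option L) (DiffAct Act)} {ρ : TimedPath L Act}
    (h : oldPath π = some ρ) : π.last = some ρ.last := by
  rcases π with (_ | l) | ⟨π, (_ | a | a), t, (_ | l)⟩ <;> simp [oldPath] at h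
  · subst h; rfl
  · obtain ⟨σ, _, rfl⟩ := h; rfl

theorem enabled_of_diffDecision_ne_zero {M : CTMDP L Act} {l : L} {p q : Act → ℝ≥0}
    (hp : ∀ a, p a ≠ 0 → a ∈ M.enabled l) {x : DiffAct Act} (hx : M.diffDecision l p q x ≠ 0) :
    x ∈ M.diff.enabled (some l) := by
  classical
  rcases x with _ | a | ⟨a, b⟩
  · simp [diffDecision] at hx
  · have ha : p a ≠ 0 := fun h => hx (by simp [diffDecision, h])
    have := mem_enabled.1 (hp a ha)
    rw [mem_enabled]
    simpa [exitRate, diff, diffRate, Fintype.sum_option] using this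
  · have hs : M.surplusAction l p q = some a := by
      by_contra h
      exact hx (by simp [diffDecision, h])
    have ha : 0 < M.exitRate l a := mem_enabled.1 (hp a (pos_of_gt (surplusAction_spec hs)).ne')
    have hab : 0 < M.exitRate l a + M.exitRate l b := lt_of_lt_of_le ha le_self_add
    rw [mem_enabled]
    change 0 < ∑ l', M.diffRate (some l) (some (.inr (a, b))) l'
    rw [Fintype.sum_option]
    exact lt_of_lt_of_le hab le_self_add

open Classical in
/-- The difference scheduler of two schedulers: on histories that use only old actions it decides
as above, in the fresh goal location it chooses the only enabled action. (The remaining histories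
cannot occur; some enabled action is chosen there.) -/
noncomputable def Scheduler.diff {M : CTMDP L Act} (D E : M.Scheduler) : M.diff.Scheduler where
  prob π t x :=
    match oldPath π with
    | some ρ => M.diffDecision ρ.last (D.prob ρ t) (E.prob ρ t) x
    | none => if x = (M.diff.exists_enabled π.last).choose then 1 else 0
  sum_eq_one π t := by
    rcases h : oldPath π with _ | ρ
    · simp
    · simpa using sum_diffDecision (D.sum_eq_one ρ t) (E.sum_eq_one ρ t)
  enabled_of_ne_zero π t x hx := by
    rcases h : oldPath π with _ | ρ
    · simp only [h] at hx
      have hx' : x = (M.diff.exists_enabled π.last).choose := by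
        by_contra hne
        exact hx (if_neg hne)
      rw [hx', mem_enabled]
      exact (M.diff.exists_enabled π.last).choose_spec
    · simp only [h] at hx
      rw [last_of_oldPath h]
      exact enabled_of_diffDecision_ne_zero (D.enabled_of_ne_zero ρ t) hx

/-- The distance of two schedulers: the probability that the difference scheduler reaches the
fresh goal location within the time bound `T`, i.e. that the two act observably different. -/
noncomputable def Scheduler.distance {M : CTMDP L Act} (T : ℝ) (D E : M.Scheduler) : ℝ :=
  (D.diff E).totalReachProb T

/-- A measurable THR scheduler for the time bound `T`, represented by a Cauchy sequence of
cylindrical THR schedulers. -/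
structure MeasurableScheduler (M : CTMDP L Act) (T : ℝ) where
  seq : ℕ → M.Scheduler
  cylindrical : ∀ n, (seq n).IsCylindrical T
  cauchy : ∀ ε > 0, ∃ N, ∀ m > N, ∀ n > N, Scheduler.distance T (seq m) (seq n) < ε

namespace MeasurableScheduler

variable {M : CTMDP L Act} {T : ℝ}

/-- `Pr_S(l,t) = p`: the reachability probability of a Cauchy sequence is the limit of those of its
elements. -/
def HasReachProb (S : M.MeasurableScheduler T) (l : L) (t p : ℝ) : Prop :=
  Tendsto (fun n => (S.seq n).reachProb T l t) atTop (𝓝 p)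

/-- `∑ₗ ν(l) Pr_S(l,0) = p`, again as a limit along the Cauchy sequence. -/
def HasTotalReachProb (S : M.MeasurableScheduler T) (p : ℝ) : Prop :=
  Tendsto (fun n => (S.seq n).totalReachProb T) atTop (𝓝 p)

end MeasurableScheduler

end CTMDP

/-! For a cylindrical scheduler, the reachability probability `u π t`, as a function of the whole
history `π` and the time `t`, solves a linear backward equation: off the finite set `J` of
endpoints, `u' = e u - jump u`, where `e` is the expected exit rate and `jump u` averages `u` over
the one-step extensions of `π`; at time `T` it is the indicator that `π` has visited the goal. This
is `CylindricalWith.reachProbFrom_eq`, obtained by summing the recursion for exactly `n` further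
transitions.

Such equations obey a comparison principle (`CylindricalWith.nonpos_of_subsolution`): iterating the
variation of constants formula `n` times bounds a subsolution by `K (C (T - t)) ^ n / n!`, where `C`
bounds all exit rates, and this tends to `0`. Evaluate `fmax` at the last location of a history, and
replace it by `1` once the goal has been visited. The result is a supersolution, because an average
of drifts over enabled actions is at most their maximum; dually, `fmin` gives a subsolution. This
proves both bounds for cylindrical schedulers.

The same principle controls limits. On histories with old actions only, the gap between the
probabilities of `D` and `E` is a subsolution of the backward equation of the difference process
(`CylindricalWith.reachGap_le`), so it is at most the probability that this process reaches its
fresh goal. Weighted by the initial distribution at time `0`, the latter is the distance. For a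
single location `l` and a time `t`, one divides by the initial mass of `l` and by a lower bound for
the probability of staying in `l` up to time `t`. Hence the probabilities along a Cauchy sequence of
schedulers are Cauchy, and the bounds pass to the limit. -/

/-! ### Piecewise continuous functions and variation of constants -/

/-- `f` is bounded on `[c, T]` and continuous on `(c, T)` outside of the finite set `J`. -/
structure PiecewiseBounded (J : Finset ℝ) (c T : ℝ) (f : ℝ → ℝ) : Prop where
  cont : ContinuousOn f (Set.Ioo c T \ J)
  bdd : ∃ K, ∀ t ∈ Set.Icc c T, |f t| ≤ K

namespace PiecewiseBounded

variable {J : Finset ℝ} {c T : ℝ} {f g : ℝ → ℝ}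

theorem isOpen_diff (J : Finset ℝ) (c T : ℝ) : IsOpen (Set.Ioo c T \ (J : Set ℝ)) :=
  isOpen_Ioo.sdiff J.finite_toSet.isClosed

theorem add (hf : PiecewiseBounded J c T f) (hg : PiecewiseBounded J c T g) :
    PiecewiseBounded J c T fun t => f t + g t := by
  refine ⟨hf.cont.add hg.cont, ?_⟩
  obtain ⟨K, hK⟩ := hf.bdd
  obtain ⟨K', hK'⟩ := hg.bdd
  exact ⟨K + K', fun t ht => (abs_add_le _ _).trans (add_le_add (hK t ht) (hK' t ht))⟩

theorem neg (hf : PiecewiseBounded J c T f) : PiecewiseBounded J c T fun t => -f t := by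
  refine ⟨hf.cont.neg, ?_⟩
  obtain ⟨K, hK⟩ := hf.bdd
  exact ⟨K, fun t ht => by rw [abs_neg]; exact hK t ht⟩

theorem sub (hf : PiecewiseBounded J c T f) (hg : PiecewiseBounded J c T g) :
    PiecewiseBounded J c T fun t => f t - g t := by
  simpa only [sub_eq_add_neg] using hf.add hg.neg

theorem mul (hf : PiecewiseBounded J c T f) (hg : PiecewiseBounded J c T g) :
    PiecewiseBounded J c T fun t => f t * g t := by
  refine ⟨hf.cont.mul hg.cont, ?_⟩
  obtain ⟨K, hK⟩ := hf.bdd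
  obtain ⟨K', hK'⟩ := hg.bdd
  refine ⟨K * K', fun t ht => ?_⟩
  rw [abs_mul]
  exact mul_le_mul (hK t ht) (hK' t ht) (abs_nonneg _) ((abs_nonneg _).trans (hK t ht))

theorem of_continuousOn (hf : ContinuousOn f (Set.Icc c T)) : PiecewiseBounded J c T f := by
  refine ⟨hf.mono (Set.sdiff_subset.trans Set.Ioo_subset_Icc_self), ?_⟩
  obtain ⟨K, hK⟩ := isCompact_Icc.exists_bound_of_continuousOn hf
  exact ⟨K, hK⟩

theorem const (r : ℝ) : PiecewiseBounded J c T fun _ => r := of_continuousOn continuousOn_const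

theorem sum {ι : Type*} (s : Finset ι) {F : ι → ℝ → ℝ} (hF : ∀ i ∈ s, PiecewiseBounded J c T (F i)) :
    PiecewiseBounded J c T fun t => ∑ i ∈ s, F i t := by
  classical
  induction s using Finset.induction_on with
  | empty => simpa using const 0
  | insert i s hi ih =>
    simp only [Finset.sum_insert hi]
    exact (hF i (Finset.mem_insert_self i s)).add
      (ih fun j hj => hF j (Finset.mem_insert_of_mem hj))

theorem integrableOn (hf : PiecewiseBounded J c T f) : IntegrableOn f (Set.Icc c T) := by
  obtain ⟨K, hK⟩ := hf.bdd
  have hae : (Set.Ioo c T \ (J : Set ℝ) : Set ℝ) =ᵐ[volume] Set.Icc c T := by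
    refine (sdiff_null_ae_eq_self ?_).trans Ioo_ae_eq_Icc
    exact J.finite_toSet.measure_zero _
  refine IntegrableOn.of_bound (C := K) (by simp) ?_ ?_
  · rw [← Measure.restrict_congr_set hae]
    exact hf.cont.aestronglyMeasurable (isOpen_diff J c T).measurableSet
  · exact (ae_restrict_iff' measurableSet_Icc).2 (Eventually.of_forall hK)

theorem intervalIntegrable (hf : PiecewiseBounded J c T f) {a b : ℝ} (ha : a ∈ Set.Icc c T)
    (hb : b ∈ Set.Icc c T) : IntervalIntegrable f volume a b := by
  refine (hf.integrableOn.mono_set ?_).intervalIntegrable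
  exact Set.uIcc_subset_Icc ha hb

theorem continuousOn_integral (hf : PiecewiseBounded J c T f) :
    ContinuousOn (fun t => ∫ s in t..T, f s) (Set.Icc c T) := by
  rcases le_or_gt c T with h | h
  · rw [← Set.uIcc_of_le h]
    refine intervalIntegral.continuousOn_primitive_interval_left ?_
    rw [Set.uIcc_of_le h]
    exact hf.integrableOn
  · rw [Set.Icc_eq_empty h.not_ge]
    exact continuousOn_empty _

theorem hasDerivAt_integral (hf : PiecewiseBounded J c T f) {t : ℝ}
    (ht : t ∈ Set.Ioo c T \ (J : Set ℝ)) : HasDerivAt (fun t => ∫ s in t..T, f s) (-f t) t :=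
  intervalIntegral.integral_hasDerivAt_left
    (hf.intervalIntegrable ⟨ht.1.1.le, ht.1.2.le⟩ ⟨(ht.1.1.trans ht.1.2).le, le_rfl⟩)
    (hf.cont.stronglyMeasurableAtFilter (isOpen_diff J c T) t ht)
    (hf.cont.continuousAt ((isOpen_diff J c T).mem_nhds ht))

theorem exp_integral (hf : PiecewiseBounded J c T f) :
    ContinuousOn (fun t => Real.exp (∫ s in t..T, f s)) (Set.Icc c T) :=
  hf.continuousOn_integral.rexp

theorem integral_sub_eq (hf : PiecewiseBounded J c T f) {t s : ℝ} (ht : t ∈ Set.Icc c T)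
    (hs : s ∈ Set.Icc c T) :
    ∫ u in t..s, f u = (∫ u in t..T, f u) - ∫ u in s..T, f u := by
  have hT : T ∈ Set.Icc c T := ⟨ht.1.trans ht.2, le_rfl⟩
  rw [eq_sub_iff_add_eq]
  exact intervalIntegral.integral_add_adjacent_intervals (hf.intervalIntegrable ht hs)
    (hf.intervalIntegrable hs hT)

theorem exp_neg_integral (hf : PiecewiseBounded J c T f) {t : ℝ} (ht : t ∈ Set.Icc c T) :
    ContinuousOn (fun s => Real.exp (-∫ u in t..s, f u)) (Set.Icc c T) := by
  have : ContinuousOn (fun s => Real.exp (-((∫ u in t..T, f u) - ∫ u in s..T, f u)))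
      (Set.Icc c T) := (continuousOn_const.sub hf.continuousOn_integral).neg.rexp
  exact this.congr fun s hs => by simp only [hf.integral_sub_eq ht hs]

/-- The solution of `y' = e y - q`, `y(T) = b`. -/
noncomputable def duhamel (T b : ℝ) (e q : ℝ → ℝ) (t : ℝ) : ℝ :=
  b * Real.exp (-∫ u in t..T, e u) + ∫ s in t..T, Real.exp (-∫ u in t..s, e u) * q s

/-- Splitting the exponent at `T` leaves `t` only in an outer factor and in a lower limit of
integration, so continuity and differentiability in `t` reduce to those of primitives. -/
theorem duhamel_eq (hf : PiecewiseBounded J c T f) (b : ℝ) {t : ℝ}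
    (ht : t ∈ Set.Icc c T) : duhamel T b f g t = Real.exp (-∫ u in t..T, f u) *
      (b + ∫ s in t..T, Real.exp (∫ u in s..T, f u) * g s) := by
  have h : ∀ s ∈ Set.uIcc t T, Real.exp (-∫ u in t..s, f u) * g s =
      Real.exp (-∫ u in t..T, f u) * (Real.exp (∫ u in s..T, f u) * g s) := by
    intro s hs
    rw [Set.uIcc_of_le ht.2] at hs
    rw [hf.integral_sub_eq ht ⟨ht.1.trans hs.1, hs.2⟩, neg_sub, sub_eq_add_neg, add_comm,
      Real.exp_add, mul_assoc]
  rw [duhamel, intervalIntegral.integral_congr h, intervalIntegral.integral_const_mul]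
  ring

theorem continuousOn_duhamel (hf : PiecewiseBounded J c T f) (hg : PiecewiseBounded J c T g)
    (b : ℝ) : ContinuousOn (duhamel T b f g) (Set.Icc c T) := by
  have h := hf.continuousOn_integral.neg.rexp.mul
    (continuousOn_const (c := b) |>.add
      ((of_continuousOn hf.exp_integral).mul hg).continuousOn_integral)
  exact h.congr fun t ht => hf.duhamel_eq b ht

theorem hasDerivAt_duhamel (hf : PiecewiseBounded J c T f) (hg : PiecewiseBounded J c T g)
    (b : ℝ) {t : ℝ} (ht : t ∈ Set.Ioo c T \ (J : Set ℝ)) :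
    HasDerivAt (duhamel T b f g) (f t * duhamel T b f g t - g t) t := by
  have h := (hf.hasDerivAt_integral ht).neg.exp.mul
    ((((of_continuousOn (J := J) hf.exp_integral).mul hg).hasDerivAt_integral ht).const_add b)
  refine (h.congr_of_eventuallyEq ?_).congr_deriv ?_
  · filter_upwards [(isOpen_diff J c T).mem_nhds ht] with s hs
    simpa using hf.duhamel_eq b ⟨hs.1.1.le, hs.1.2.le⟩
  · rw [hf.duhamel_eq b ⟨ht.1.1.le, ht.1.2.le⟩]
    have : Real.exp (-∫ u in t..T, f u) * Real.exp (∫ u in t..T, f u) = 1 := by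
      rw [← Real.exp_add, neg_add_cancel, Real.exp_zero]
    simp only [Pi.neg_apply]
    linear_combination (-g t) * this

/-- Variation of constants. -/
theorem eq_duhamel (hf : PiecewiseBounded J c T f) (hg : PiecewiseBounded J c T g)
    {y : ℝ → ℝ} (hy : ContinuousOn y (Set.Icc c T))
    (hd : ∀ t ∈ Set.Ioo c T \ (J : Set ℝ), HasDerivAt y (f t * y t - g t) t)
    {t : ℝ} (ht : t ∈ Set.Icc c T) : y t = duhamel T (y T) f g t := by
  have hsub : Set.Icc t T ⊆ Set.Icc c T := Set.Icc_subset_Icc_left ht.1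
  have hT : T ∈ Set.Icc c T := ⟨ht.1.trans ht.2, le_rfl⟩
  -- With the integrating factor, the derivative of `exp (∫ f) * y` no longer contains `y`.
  -- Continuity of `y` allows the finitely many exceptional points.
  have key := integral_eq_of_hasDerivAt_off_countable_of_le
    (fun s => Real.exp (∫ u in s..T, f u) * y s) (fun s => -(Real.exp (∫ u in s..T, f u) * g s))
    ht.2 (s := (J : Set ℝ)) J.countable_toSet ((hf.exp_integral.mul hy).mono hsub)
    (fun s hs => ?_)
    (((of_continuousOn hf.exp_integral).mul hg).neg.intervalIntegrable ht hT)
  · rw [hf.duhamel_eq _ ht]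
    rw [intervalIntegral.integral_neg] at key
    simp only [intervalIntegral.integral_same, Real.exp_zero, one_mul] at key
    have : Real.exp (-∫ u in t..T, f u) * Real.exp (∫ u in t..T, f u) = 1 := by
      rw [← Real.exp_add, neg_add_cancel, Real.exp_zero]
    linear_combination Real.exp (-∫ u in t..T, f u) * key - y t * this
  · have hs' : s ∈ Set.Ioo c T \ (J : Set ℝ) := ⟨⟨ht.1.trans_lt hs.1.1, hs.1.2⟩, hs.2⟩
    exact ((hf.hasDerivAt_integral hs').exp.mul (hd s hs')).congr_deriv (by ring)

end PiecewiseBounded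

/-! ### Paths, cells and cylinders -/

theorem SameCell.mono {J J' : Finset ℝ} (hJ : J ⊆ J') {s t : ℝ} (h : SameCell J' s t) :
    SameCell J s t := fun c hc => h c (hJ hc)

/-- The cells are intervals with endpoints in `J`; this is the source of all piecewise continuity
below. -/
theorem exists_sameCell_nhds {J : Finset ℝ} {s : ℝ} (hs : s ∉ J) :
    ∀ᶠ t in 𝓝 s, SameCell J t s := by
  have : ∀ c ∈ J, ∀ᶠ t in 𝓝 s, (t ≤ c ↔ s ≤ c) := by
    intro c hc
    rcases lt_trichotomy s c with h | h | h
    · filter_upwards [Iio_mem_nhds h] with t ht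
      exact iff_of_true (le_of_lt ht) h.le
    · exact absurd (h ▸ hc) hs
    · filter_upwards [Ioi_mem_nhds h] with t ht
      exact iff_of_false (not_le.2 ht) (not_le.2 h)
  exact (Filter.eventually_all_finset J).2 this

namespace TimedPath

variable {L Act : Type*} {J J' : Finset ℝ} {T : ℝ}

theorem IsTimed.clock_nonneg : ∀ {π : TimedPath L Act}, π.IsTimed T → 0 ≤ π.clock
  | start _, _ => le_rfl
  | step _ _ _ _, h => (IsTimed.clock_nonneg h.1).trans h.2.1

theorem SameCylinder.refl : ∀ π : TimedPath L Act, SameCylinder J π π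
  | start _ => rfl
  | step π _ _ _ => ⟨SameCylinder.refl π, rfl, fun _ _ => Iff.rfl, rfl⟩

theorem SameCylinder.mono (hJ : J ⊆ J') :
    ∀ {π π' : TimedPath L Act}, SameCylinder J' π π' → SameCylinder J π π'
  | start _, start _, h => h
  | step _ _ _ _, step _ _ _ _, h => ⟨SameCylinder.mono hJ h.1, h.2.1, h.2.2.1.mono hJ, h.2.2.2⟩

theorem SameCylinder.last_eq :
    ∀ {π π' : TimedPath L Act}, SameCylinder J π π' → π.last = π'.last
  | start _, start _, h => h
  | step _ _ _ _, step _ _ _ _, h => h.2.2.2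

theorem SameCylinder.visits_iff {G : Set L} :
    ∀ {π π' : TimedPath L Act}, SameCylinder J π π' → (π.Visits G ↔ π'.Visits G)
  | start _, start _, h => by cases (h : _ = _); rfl
  | step _ _ _ _, step _ _ _ _, h => by
    obtain ⟨h₁, -, -, rfl⟩ := h
    exact or_congr (SameCylinder.visits_iff h₁) Iff.rfl

theorem visits_of_last_mem {G : Set L} : ∀ {π : TimedPath L Act}, π.last ∈ G → π.Visits G
  | start _, h => h
  | step _ _ _ _, h => Or.inr h

end TimedPath

/-! ### Terms of the exponential series as bounds for `n` transitions. -/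

/-- The term `(C (T - t)) ^ n / n!` of the exponential series. -/
noncomputable def expTerm (C T : ℝ) (n : ℕ) (t : ℝ) : ℝ := (C * (T - t)) ^ n / n.factorial

theorem expTerm_nonneg {C T t : ℝ} (hC : 0 ≤ C) (ht : t ≤ T) (n : ℕ) : 0 ≤ expTerm C T n t :=
  div_nonneg (pow_nonneg (mul_nonneg hC (sub_nonneg.2 ht)) n) (Nat.cast_nonneg _)

theorem continuous_expTerm (C T : ℝ) (n : ℕ) : Continuous (expTerm C T n) := by
  unfold expTerm
  fun_prop

/-- One more transition costs one integration against the rate bound `C`; this drives the inductions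
in `pathProb_le` and `nonpos_of_subsolution`. -/
theorem integral_expTerm (C T : ℝ) (n : ℕ) (t : ℝ) :
    ∫ s in t..T, C * expTerm C T n s = expTerm C T (n + 1) t := by
  have hd : ∀ s ∈ Set.uIcc t T,
      HasDerivAt (fun s => -expTerm C T (n + 1) s) (C * expTerm C T n s) s := by
    intro s _
    have h := ((((hasDerivAt_id s).const_sub T).const_mul C).pow (n + 1)).div_const
      ((n + 1).factorial : ℝ) |>.neg
    refine h.congr_deriv ?_
    have : (n.factorial : ℝ) ≠ 0 := Nat.cast_ne_zero.2 n.factorial_ne_zero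
    simp only [expTerm, Nat.factorial_succ, Nat.cast_mul, Nat.cast_add, Nat.cast_one,
      Nat.add_sub_cancel, id]
    field_simp
  rw [intervalIntegral.integral_eq_sub_of_hasDerivAt hd
    ((continuous_const.mul (continuous_expTerm C T n)).intervalIntegrable _ _)]
  simp [expTerm]

theorem expTerm_le {C T t : ℝ} (hC : 0 ≤ C) (h0 : 0 ≤ t) (ht : t ≤ T) (n : ℕ) :
    expTerm C T n t ≤ expTerm C T n 0 := by
  unfold expTerm
  have : 0 ≤ T - t := sub_nonneg.2 ht
  gcongr

theorem summable_expTerm (C T t : ℝ) : Summable fun n => expTerm C T n t :=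
  Real.summable_pow_div_factorial _

theorem tendsto_expTerm (C T t : ℝ) : Tendsto (fun n => expTerm C T n t) atTop (𝓝 0) :=
  (summable_expTerm C T t).tendsto_atTop_zero

/-! ### Cylindrical schedulers: regularity in time and dependence on histories. -/

namespace CTMDP

variable {L Act : Type*} [Fintype L] [Fintype Act] {M : CTMDP L Act}

/-- A bound for all exit rates. -/
def totalRate (M : CTMDP L Act) : ℝ≥0 := ∑ l, ∑ a, M.exitRate l a

namespace Scheduler

variable {S : M.Scheduler} {J : Finset ℝ} {T : ℝ}

theorem prob_le_one (S : M.Scheduler) (π : TimedPath L Act) (t : ℝ) (a : Act) :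
    S.prob π t a ≤ 1 := by
  rw [← S.sum_eq_one π t]
  exact Finset.single_le_sum (f := S.prob π t) (fun _ _ => zero_le) (Finset.mem_univ a)

theorem exitRate_le (S : M.Scheduler) (π : TimedPath L Act) (t : ℝ) :
    S.exitRate π t ≤ M.totalRate :=
  calc S.exitRate π t ≤ ∑ a, M.exitRate π.last a :=
        Finset.sum_le_sum fun a _ => mul_le_of_le_one_left' (S.prob_le_one π t a)
    _ ≤ M.totalRate := Finset.single_le_sum (f := fun l => ∑ a, M.exitRate l a)
        (fun _ _ => zero_le) (Finset.mem_univ _)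

theorem sum_rates (S : M.Scheduler) (π : TimedPath L Act) (t : ℝ) :
    ∑ a, ∑ l', S.prob π t a * M.rate π.last a l' = S.exitRate π t := by
  simp only [exitRate, CTMDP.exitRate, Finset.mul_sum]

/-- The decisions depend only on the cylindrification with respect to the endpoints `J`. -/
def CylindricalWith (S : M.Scheduler) (T : ℝ) (J : Finset ℝ) : Prop :=
  ∀ π π' : TimedPath L Act, ∀ t ∈ Set.Icc 0 T, ∀ t' ∈ Set.Icc 0 T,
    π.IsTimed T → π'.IsTimed T → TimedPath.SameCylinder J π π' → SameCell J t t' →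
      S.prob π t = S.prob π' t'

theorem CylindricalWith.mono {J' : Finset ℝ} (hS : S.CylindricalWith T J) (hJ : J ⊆ J') :
    S.CylindricalWith T J' := fun π π' t ht t' ht' hπ hπ' h h' =>
  hS π π' t ht t' ht' hπ hπ' (h.mono hJ) (h'.mono hJ)

theorem CylindricalWith.exitRate_eq (hS : S.CylindricalWith T J) {π π' : TimedPath L Act}
    (hπ : π.IsTimed T) (hπ' : π'.IsTimed T) (h : TimedPath.SameCylinder J π π') {t : ℝ}
    (ht : t ∈ Set.Icc 0 T) : S.exitRate π t = S.exitRate π' t := by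
  simp only [exitRate, h.last_eq, hS π π' t ht t ht hπ hπ' h fun _ _ => Iff.rfl]

/-- Off `J` the decision is locally constant in time, since nearby times lie in one cell. -/
theorem CylindricalWith.piecewiseBounded_prob (hS : S.CylindricalWith T J)
    {π : TimedPath L Act} (hπ : π.IsTimed T) (a : Act) :
    PiecewiseBounded J π.clock T fun t => (S.prob π t a : ℝ) := by
  refine ⟨fun t ht => ContinuousAt.continuousWithinAt ?_, 1, fun t _ => ?_⟩
  · have hev : (fun s => (S.prob π s a : ℝ)) =ᶠ[𝓝 t] fun _ => (S.prob π t a : ℝ) := by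
      filter_upwards [exists_sameCell_nhds (fun h => ht.2 (Finset.mem_coe.2 h)),
        isOpen_Ioo.mem_nhds ht.1] with s hs hs'
      rw [hS π π s ⟨hπ.clock_nonneg.trans hs'.1.le, hs'.2.le⟩ t
        ⟨hπ.clock_nonneg.trans ht.1.1.le, ht.1.2.le⟩ hπ hπ (TimedPath.SameCylinder.refl π) hs]
    exact continuousAt_const.congr hev.symm
  · rw [abs_of_nonneg (NNReal.coe_nonneg _)]
    exact_mod_cast S.prob_le_one π t a

theorem CylindricalWith.piecewiseBounded_exitRate (hS : S.CylindricalWith T J)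
    {π : TimedPath L Act} (hπ : π.IsTimed T) :
    PiecewiseBounded J π.clock T fun t => (S.exitRate π t : ℝ) := by
  simp only [exitRate, NNReal.coe_sum, NNReal.coe_mul]
  exact PiecewiseBounded.sum _ fun a _ =>
    (hS.piecewiseBounded_prob hπ a).mul (PiecewiseBounded.const _)

theorem survival_le_one (S : M.Scheduler) (π : TimedPath L Act) {t s : ℝ} (h : t ≤ s) :
    S.survival π t s ≤ 1 := by
  rw [survival, ENNReal.ofReal_le_one, Real.exp_le_one_iff, neg_nonpos]
  exact intervalIntegral.integral_nonneg h fun _ _ => NNReal.coe_nonneg _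

/-- Survival probabilities are at most `1` and every transition has total rate at most `C`, so `n`
ordered transition times contribute at most `C ^ n` times the volume of a simplex. The bound is
summable in `n`, which is what makes the series over `n` manageable. -/
theorem pathProb_le (S : M.Scheduler) (A : Set (TimedPath L Act)) (n : ℕ) :
    ∀ (π : TimedPath L Act) {t : ℝ}, t ≤ T →
      S.pathProb T A n π t ≤ ENNReal.ofReal (expTerm M.totalRate T n t) := by
  induction n with
  | zero =>
    intro π t ht
    simp only [pathProb, expTerm, pow_zero, Nat.factorial_zero, Nat.cast_one, div_one,
      ENNReal.ofReal_one]
    refine mul_le_one' ?_ (S.survival_le_one π ht)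
    exact Set.indicator_le_self' (fun _ _ => zero_le) π
  | succ n ih =>
    intro π t ht
    have hnn : ∀ s, s ≤ T → 0 ≤ (M.totalRate : ℝ) * expTerm M.totalRate T n s := fun s hs =>
      mul_nonneg (NNReal.coe_nonneg _) (expTerm_nonneg (NNReal.coe_nonneg _) hs n)
    rw [← integral_expTerm, intervalIntegral.integral_of_le ht,
      ofReal_integral_eq_lintegral_ofReal]
    · refine setLIntegral_mono' measurableSet_Ioc fun s hs => ?_
      refine (mul_le_of_le_one_left' (S.survival_le_one π hs.1.le)).trans ?_
      calc _ ≤ ∑ a, ∑ l', ((S.prob π s a * M.rate π.last a l' : ℝ≥0) : ℝ≥0∞) *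
              ENNReal.ofReal (expTerm M.totalRate T n s) := by
            gcongr with a _ l' _
            exact ih _ hs.2
        _ = (S.exitRate π s : ℝ≥0∞) * ENNReal.ofReal (expTerm M.totalRate T n s) := by
            simp only [← Finset.sum_mul]
            rw [← S.sum_rates π s]
            push_cast
            rfl
        _ ≤ (M.totalRate : ℝ≥0∞) * ENNReal.ofReal (expTerm M.totalRate T n s) := by
            gcongr
            exact S.exitRate_le π s
        _ = _ := by
            rw [ENNReal.ofReal_mul (NNReal.coe_nonneg _), ENNReal.ofReal_coe_nnreal]
    · exact (((continuous_const.mul (continuous_expTerm _ T n)).intervalIntegrable t T).1)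
    · exact (ae_restrict_iff' measurableSet_Ioc).2 (Eventually.of_forall fun s hs => hnn s hs.2)

theorem pathProb_ne_top (S : M.Scheduler) (A : Set (TimedPath L Act)) (n : ℕ)
    (π : TimedPath L Act) {t : ℝ} (ht : t ≤ T) : S.pathProb T A n π t ≠ ∞ :=
  ((S.pathProb_le A n π ht).trans_lt ENNReal.ofReal_lt_top).ne

/-- Appending the same transition at the same time to two paths in one cylinder keeps them in one
cylinder, so all later decisions agree as well. -/
theorem CylindricalWith.pathProb_eq (hS : S.CylindricalWith T J) (G : Set L) (n : ℕ) :
    ∀ {π π' : TimedPath L Act}, π.IsTimed T → π'.IsTimed T →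
      TimedPath.SameCylinder J π π' → ∀ {t : ℝ}, t ≤ T → π.clock ≤ t → π'.clock ≤ t →
      S.pathProb T {ρ | ρ.Visits G} n π t = S.pathProb T {ρ | ρ.Visits G} n π' t := by
  have hsurv : ∀ {π π' : TimedPath L Act}, π.IsTimed T → π'.IsTimed T →
      TimedPath.SameCylinder J π π' → ∀ {t s : ℝ}, t ≤ s → s ≤ T → π.clock ≤ t →
      S.survival π t s = S.survival π' t s := by
    intro π π' hπ hπ' h t s hts hs ht
    rw [survival, survival, intervalIntegral.integral_congr fun u hu => ?_]
    rw [Set.uIcc_of_le hts] at hu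
    exact congrArg _ (hS.exitRate_eq hπ hπ' h
      ⟨hπ.clock_nonneg.trans (ht.trans hu.1), hu.2.trans hs⟩)
  induction n with
  | zero =>
    intro π π' hπ hπ' h t ht hc hc'
    simp only [pathProb, hsurv hπ hπ' h ht le_rfl hc]
    congr 1
    by_cases hv : π.Visits G
    · rw [Set.indicator_of_mem (show π ∈ {ρ | ρ.Visits G} from hv),
        Set.indicator_of_mem (show π' ∈ {ρ | ρ.Visits G} from h.visits_iff.1 hv)]
    · rw [Set.indicator_of_notMem (show π ∉ {ρ | ρ.Visits G} from hv),
        Set.indicator_of_notMem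
          (show π' ∉ {ρ | ρ.Visits G} from fun hv' => hv (h.visits_iff.2 hv'))]
  | succ n ih =>
    intro π π' hπ hπ' h t ht hc hc'
    refine setLIntegral_congr_fun measurableSet_Ioc fun s hs => ?_
    have hs0 : s ∈ Set.Icc 0 T := ⟨hπ.clock_nonneg.trans (hc.trans hs.1.le), hs.2⟩
    simp only [hsurv hπ hπ' h hs.1.le hs.2 hc,
      hS π π' s hs0 s hs0 hπ hπ' h fun _ _ => Iff.rfl, h.last_eq]
    congr 1
    refine Finset.sum_congr rfl fun a _ => Finset.sum_congr rfl fun l' _ => ?_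
    congr 1
    exact ih (π := π.step a s l') (π' := π'.step a s l') ⟨hπ, hc.trans hs.1.le, hs.2⟩ ⟨hπ', hc'.trans hs.1.le, hs.2⟩
      ⟨h, rfl, fun _ _ => Iff.rfl, rfl⟩ hs.2 le_rfl le_rfl

end Scheduler

end CTMDP

/-! ### Functions of histories, and the comparison principle. -/

open PiecewiseBounded (duhamel)

/-- A bounded function of timed paths and times that depends on the path only through its
cylindrification and is continuous in time. -/
structure TamePathFun {L Act : Type*} (J : Finset ℝ) (T : ℝ) (w : TimedPath L Act → ℝ → ℝ) :
    Prop where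
  inv : ∀ π π' : TimedPath L Act, π.IsTimed T → π'.IsTimed T → TimedPath.SameCylinder J π π' →
    ∀ t ≤ T, π.clock ≤ t → π'.clock ≤ t → w π t = w π' t
  cont : ∀ π : TimedPath L Act, π.IsTimed T → ContinuousOn (w π) (Set.Icc π.clock T)
  bdd : ∃ K, ∀ π : TimedPath L Act, π.IsTimed T → ∀ t ∈ Set.Icc π.clock T, |w π t| ≤ K

namespace TamePathFun

variable {L Act : Type*} {J : Finset ℝ} {T : ℝ} {w w' : TimedPath L Act → ℝ → ℝ}

theorem sub (hw : TamePathFun J T w) (hw' : TamePathFun J T w') :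
    TamePathFun J T fun π t => w π t - w' π t where
  inv π π' hπ hπ' h t ht hc hc' := by
    rw [hw.inv π π' hπ hπ' h t ht hc hc', hw'.inv π π' hπ hπ' h t ht hc hc']
  cont π hπ := (hw.cont π hπ).sub (hw'.cont π hπ)
  bdd := by
    obtain ⟨K, hK⟩ := hw.bdd
    obtain ⟨K', hK'⟩ := hw'.bdd
    exact ⟨K + K', fun π hπ t ht =>
      (abs_sub _ _).trans (add_le_add (hK π hπ t ht) (hK' π hπ t ht))⟩

theorem const (r : ℝ) : TamePathFun J T fun (_ : TimedPath L Act) (_ : ℝ) => r :=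
  ⟨fun _ _ _ _ _ _ _ _ _ => rfl, fun _ _ => continuousOn_const, |r|, fun _ _ _ _ => le_rfl⟩

theorem piecewiseBounded (hw : TamePathFun J T w) {π : TimedPath L Act} (hπ : π.IsTimed T) :
    PiecewiseBounded J π.clock T (w π) :=
  PiecewiseBounded.of_continuousOn (hw.cont π hπ)

/-- Here `s` is both the last transition time and the current time. By invariance the transition
time may be frozen within its cell, which leaves continuity in the current time alone. -/
theorem piecewiseBounded_step (hw : TamePathFun J T w) {π : TimedPath L Act} (hπ : π.IsTimed T)
    (a : Act) (l' : L) : PiecewiseBounded J π.clock T fun s => w (π.step a s l') s := by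
  refine ⟨fun s hs => ContinuousAt.continuousWithinAt ?_, ?_⟩
  · have hev := (exists_sameCell_nhds (J := J) (s := s)
      (fun h => hs.2 (Finset.mem_coe.2 h))).and (isOpen_Ioo.mem_nhds hs.1)
    obtain ⟨ε, hε, hball⟩ := Metric.eventually_nhds_iff.1 hev
    -- The frozen transition time lies strictly before `s`, so that current times on both sides of
    -- `s` come after it.
    have hr : s - ε / 2 < s := by linarith
    obtain ⟨hcell, hr₁, hr₂⟩ := @hball (s - ε / 2) (by
      rw [Real.dist_eq, sub_sub_cancel_left, abs_neg, abs_of_pos (by linarith)]; linarith)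
    set r := s - ε / 2 with hrdef
    have htimed : (π.step a r l').IsTimed T := ⟨hπ, hr₁.le, hr₂.le⟩
    have hca : ContinuousAt (w (π.step a r l')) s :=
      (hw.cont _ htimed).continuousAt (Icc_mem_nhds hr hs.1.2)
    refine hca.congr ?_
    filter_upwards [Metric.ball_mem_nhds s hε, Ioi_mem_nhds hr] with u hu hur
    obtain ⟨hucell, hu₁, hu₂⟩ := hball hu
    refine hw.inv (π.step a r l') (π.step a u l') htimed ⟨hπ, hu₁.le, hu₂.le⟩
      ⟨TimedPath.SameCylinder.refl π, rfl, ?_, rfl⟩ u hu₂.le (le_of_lt hur) le_rfl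
    exact fun c hc => (hcell c hc).trans (hucell c hc).symm
  · obtain ⟨K, hK⟩ := hw.bdd
    exact ⟨K, fun t ht => hK (π.step a t l') ⟨hπ, ht.1, ht.2⟩ t ⟨le_rfl, ht.2⟩⟩

end TamePathFun

namespace CTMDP

variable {L Act : Type*} [Fintype L] [Fintype Act] {M : CTMDP L Act}

namespace Scheduler

variable {S : M.Scheduler} {J : Finset ℝ} {T : ℝ} {w w' : TimedPath L Act → ℝ → ℝ}

/-- The jump part of the generator. -/
def jump (S : M.Scheduler) (w : TimedPath L Act → ℝ → ℝ) (π : TimedPath L Act) (s : ℝ) : ℝ :=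
  ∑ a, ∑ l', (S.prob π s a * M.rate π.last a l' : ℝ) * w (π.step a s l') s

theorem jump_mono {π : TimedPath L Act} {s : ℝ}
    (h : ∀ a l', w (π.step a s l') s ≤ w' (π.step a s l') s) :
    S.jump w π s ≤ S.jump w' π s := by
  unfold jump
  gcongr with a _ l' _
  exact h a l'

theorem jump_sub (S : M.Scheduler) (w w' : TimedPath L Act → ℝ → ℝ) (π : TimedPath L Act)
    (s : ℝ) : S.jump (fun π t => w π t - w' π t) π s = S.jump w π s - S.jump w' π s := by
  simp only [jump, mul_sub, Finset.sum_sub_distrib]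

theorem sum_real_rates (S : M.Scheduler) (π : TimedPath L Act) (s : ℝ) :
    ∑ a, ∑ l', (S.prob π s a * M.rate π.last a l' : ℝ) = S.exitRate π s := by
  rw [← S.sum_rates π s]
  push_cast
  rfl

theorem jump_const (S : M.Scheduler) (r : ℝ) (π : TimedPath L Act) (s : ℝ) :
    S.jump (fun _ _ => r) π s = S.exitRate π s * r := by
  simp only [jump, ← Finset.sum_mul, S.sum_real_rates]

theorem jump_le_totalRate_mul {r : ℝ} (hr : 0 ≤ r) {π : TimedPath L Act} {s : ℝ}
    (h : ∀ a l', w (π.step a s l') s ≤ r) : S.jump w π s ≤ M.totalRate * r :=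
  calc S.jump w π s ≤ S.jump (fun _ _ => r) π s := jump_mono h
    _ = S.exitRate π s * r := S.jump_const r π s
    _ ≤ M.totalRate * r := by
      gcongr
      exact S.exitRate_le π s

theorem CylindricalWith.piecewiseBounded_jump (hS : S.CylindricalWith T J)
    (hw : TamePathFun J T w) {π : TimedPath L Act} (hπ : π.IsTimed T) :
    PiecewiseBounded J π.clock T (S.jump w π) :=
  PiecewiseBounded.sum _ fun a _ => PiecewiseBounded.sum _ fun l' _ =>
    ((hS.piecewiseBounded_prob hπ a).mul (PiecewiseBounded.const _)).mul
      (hw.piecewiseBounded_step hπ a l')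

/-- A bounded subsolution with nonpositive terminal values is nonpositive. -/
theorem CylindricalWith.nonpos_of_subsolution (hS : S.CylindricalWith T J)
    {d q : TimedPath L Act → ℝ → ℝ} (hd : TamePathFun J T d)
    (hT : ∀ π : TimedPath L Act, π.IsTimed T → π.clock ≤ T → d π T ≤ 0)
    (hq : ∀ π : TimedPath L Act, π.IsTimed T → PiecewiseBounded J π.clock T (q π))
    (hderiv : ∀ π : TimedPath L Act, π.IsTimed T →
      ∀ t ∈ Set.Ioo π.clock T \ (J : Set ℝ), HasDerivAt (d π) (S.exitRate π t * d π t - q π t) t)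
    (hle : ∀ π : TimedPath L Act, π.IsTimed T → ∀ t ∈ Set.Icc π.clock T, q π t ≤ S.jump d π t)
    {π : TimedPath L Act} (hπ : π.IsTimed T) {t : ℝ} (ht : t ∈ Set.Icc π.clock T) :
    d π t ≤ 0 := by
  obtain ⟨K, hK⟩ := hd.bdd
  have hC : (0 : ℝ) ≤ M.totalRate := NNReal.coe_nonneg _
  -- The induction treats all histories at once, because `jump` evaluates `d` on longer ones. In the
  -- variation of constants formula the terminal term is nonpositive, and the bound for `n` inserted
  -- under the integral gives the bound for `n + 1`.
  have key : ∀ n : ℕ, ∀ π : TimedPath L Act, π.IsTimed T → ∀ t ∈ Set.Icc π.clock T,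
      d π t ≤ |K| * expTerm M.totalRate T n t := by
    intro n
    induction n with
    | zero =>
      intro π hπ t ht
      simpa [expTerm] using (le_abs_self _).trans ((hK π hπ t ht).trans (le_abs_self K))
    | succ n ih =>
      intro π hπ t ht
      have hE := hS.piecewiseBounded_exitRate hπ
      have hTm : T ∈ Set.Icc π.clock T := ⟨ht.1.trans ht.2, le_rfl⟩
      rw [hE.eq_duhamel (hq π hπ) (hd.cont π hπ) (hderiv π hπ) ht, ← integral_expTerm,
        ← intervalIntegral.integral_const_mul]
      refine add_le_of_nonpos_of_le
        (mul_nonpos_of_nonpos_of_nonneg (hT π hπ hTm.1) (Real.exp_pos _).le) ?_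
      refine intervalIntegral.integral_mono_on ht.2 ?_
        ((continuous_const.mul
          (continuous_const.mul (continuous_expTerm _ T n))).intervalIntegrable _ _) ?_
      · exact ((PiecewiseBounded.of_continuousOn (hE.exp_neg_integral ht)).mul
          (hq π hπ)).intervalIntegrable ht hTm
      · intro s hs
        have hs' : s ∈ Set.Icc π.clock T := ⟨ht.1.trans hs.1, hs.2⟩
        have hr : 0 ≤ |K| * expTerm M.totalRate T n s :=
          mul_nonneg (abs_nonneg K) (expTerm_nonneg hC hs.2 n)
        have hq' : q π s ≤ M.totalRate * (|K| * expTerm M.totalRate T n s) :=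
          (hle π hπ s hs').trans (jump_le_totalRate_mul hr fun a l' =>
            ih (π.step a s l') ⟨hπ, hs'.1, hs'.2⟩ s ⟨le_rfl, hs.2⟩)
        have he : Real.exp (-∫ u in t..s, (S.exitRate π u : ℝ)) ≤ 1 := by
          rw [Real.exp_le_one_iff, neg_nonpos]
          exact intervalIntegral.integral_nonneg hs.1 fun _ _ => NNReal.coe_nonneg _
        calc _ ≤ Real.exp (-∫ u in t..s, (S.exitRate π u : ℝ)) *
              (M.totalRate * (|K| * expTerm M.totalRate T n s)) := by gcongr
          _ ≤ M.totalRate * (|K| * expTerm M.totalRate T n s) :=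
            mul_le_of_le_one_left (mul_nonneg hC hr) he
          _ = |K| * (M.totalRate * expTerm M.totalRate T n s) := by ring
  have hlim : Tendsto (fun n => |K| * expTerm M.totalRate T n t) atTop (𝓝 0) := by
    simpa using (tendsto_expTerm (M.totalRate : ℝ) T t).const_mul |K|
  exact ge_of_tendsto' hlim fun n => key n π hπ t ht

/-! ### The reachability probabilities as a solution of the backward equation -/

open Classical in
/-- The indicator of having visited the goal region. -/
noncomputable def visited (M : CTMDP L Act) (π : TimedPath L Act) : ℝ :=
  if π.Visits M.goal then 1 else 0

theorem visited_nonneg (M : CTMDP L Act) (π : TimedPath L Act) : 0 ≤ visited M π := by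
  unfold visited; split_ifs <;> norm_num

theorem visited_le_one (M : CTMDP L Act) (π : TimedPath L Act) : visited M π ≤ 1 := by
  unfold visited; split_ifs <;> norm_num

theorem visited_of_visits {π : TimedPath L Act} (h : π.Visits M.goal) : visited M π = 1 :=
  if_pos h

theorem visited_of_not_visits {π : TimedPath L Act} (h : ¬ π.Visits M.goal) : visited M π = 0 :=
  if_neg h

theorem tame_visited (M : CTMDP L Act) : TamePathFun J T fun π _ => visited M π where
  inv π π' _ _ h _ _ _ _ := by
    by_cases hv : π.Visits M.goal
    · rw [visited_of_visits hv, visited_of_visits (h.visits_iff.1 hv)]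
    · rw [visited_of_not_visits hv, visited_of_not_visits (mt h.visits_iff.2 hv)]
  cont _ _ := continuousOn_const
  bdd := ⟨1, fun π _ _ _ => by
    rw [abs_of_nonneg (visited_nonneg M π)]; exact visited_le_one M π⟩

/-- The probability of visiting the goal region on a path with exactly `n` further transitions. -/
noncomputable def visitProb (S : M.Scheduler) (T : ℝ) (n : ℕ) (π : TimedPath L Act) (t : ℝ) : ℝ :=
  (S.pathProb T {ρ | ρ.Visits M.goal} n π t).toReal

theorem visitProb_nonneg (S : M.Scheduler) (n : ℕ) (π : TimedPath L Act) (t : ℝ) :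
    0 ≤ S.visitProb T n π t := ENNReal.toReal_nonneg

theorem visitProb_le (S : M.Scheduler) (n : ℕ) (π : TimedPath L Act) {t : ℝ} (ht : t ≤ T) :
    S.visitProb T n π t ≤ expTerm M.totalRate T n t :=
  ENNReal.toReal_le_of_le_ofReal (expTerm_nonneg (NNReal.coe_nonneg _) ht n)
    (S.pathProb_le _ n π ht)

theorem visitProb_zero (S : M.Scheduler) (π : TimedPath L Act) (t : ℝ) :
    S.visitProb T 0 π t =
      duhamel T (visited M π) (fun u => S.exitRate π u) (fun _ => 0) t := by
  classical
  have h : (0 : ℝ) ≤ Real.exp (-∫ u in t..T, (S.exitRate π u : ℝ)) := (Real.exp_pos _).le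
  simp only [visitProb, pathProb, duhamel, mul_zero, intervalIntegral.integral_zero, add_zero,
    ENNReal.toReal_mul, survival, ENNReal.toReal_ofReal h, visited, Set.indicator_apply,
    Set.mem_ofPred_eq]
  split_ifs <;> simp

/-- Tameness of the `n`-th term supplies the measurability needed to turn the `lintegral` of the
recursion into a real integral. -/
theorem CylindricalWith.visitProb_succ_of_tame (hS : S.CylindricalWith T J) {n : ℕ}
    (hv : TamePathFun J T (S.visitProb T n)) {π : TimedPath L Act} (hπ : π.IsTimed T) {t : ℝ}
    (ht : t ∈ Set.Icc π.clock T) : S.visitProb T (n + 1) π t =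
      duhamel T 0 (fun u => S.exitRate π u) (S.jump (S.visitProb T n) π) t := by
  have hE := hS.piecewiseBounded_exitRate hπ
  have hint := ((PiecewiseBounded.of_continuousOn (hE.exp_neg_integral ht)).mul
    (hS.piecewiseBounded_jump hv hπ)).intervalIntegrable ht ⟨ht.1.trans ht.2, le_rfl⟩
  have hjump : ∀ s, 0 ≤ S.jump (S.visitProb T n) π s := fun s =>
    Finset.sum_nonneg fun a _ => Finset.sum_nonneg fun l' _ =>
      mul_nonneg (mul_nonneg (NNReal.coe_nonneg _) (NNReal.coe_nonneg _))
        (S.visitProb_nonneg n _ _)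
  rw [duhamel, zero_mul, zero_add, intervalIntegral.integral_of_le ht.2,
    integral_eq_lintegral_of_nonneg_ae (Eventually.of_forall fun s =>
      mul_nonneg (Real.exp_pos _).le (hjump s)) hint.1.aestronglyMeasurable, visitProb, pathProb]
  congr 1
  refine setLIntegral_congr_fun measurableSet_Ioc fun s hs => ?_
  rw [ENNReal.ofReal_mul (Real.exp_pos _).le, survival, jump, ENNReal.ofReal_sum_of_nonneg]
  · congr 1
    refine Finset.sum_congr rfl fun a _ => ?_
    rw [ENNReal.ofReal_sum_of_nonneg]
    · refine Finset.sum_congr rfl fun l' _ => ?_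
      rw [← NNReal.coe_mul, ENNReal.ofReal_mul (NNReal.coe_nonneg _), ENNReal.ofReal_coe_nnreal,
        visitProb, ENNReal.ofReal_toReal (S.pathProb_ne_top _ n _ hs.2)]
    · exact fun l' _ => mul_nonneg (mul_nonneg (NNReal.coe_nonneg _) (NNReal.coe_nonneg _))
        (S.visitProb_nonneg n _ _)
  · exact fun a _ => Finset.sum_nonneg fun l' _ =>
      mul_nonneg (mul_nonneg (NNReal.coe_nonneg _) (NNReal.coe_nonneg _))
        (S.visitProb_nonneg n _ _)

theorem CylindricalWith.tame_visitProb (hS : S.CylindricalWith T J) (n : ℕ) :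
    TamePathFun J T (S.visitProb T n) := by
  refine ⟨fun π π' hπ hπ' h t ht hc hc' => ?_, ?_, expTerm M.totalRate T n 0, ?_⟩
  · rw [visitProb, visitProb, hS.pathProb_eq M.goal n hπ hπ' h ht hc hc']
  · induction n with
    | zero =>
      intro π hπ
      exact ((hS.piecewiseBounded_exitRate hπ).continuousOn_duhamel (PiecewiseBounded.const 0)
        (visited M π)).congr fun t _ => S.visitProb_zero π t
    | succ n ih =>
      intro π hπ
      -- Invariance and the bound are known for every `n` independently; only continuity comes from
      -- the induction hypothesis.
      have hv : TamePathFun J T (S.visitProb T n) := by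
        refine ⟨fun π π' hπ hπ' h t ht hc hc' => ?_, ih, expTerm M.totalRate T n 0,
          fun π hπ t ht => ?_⟩
        · rw [visitProb, visitProb, hS.pathProb_eq M.goal n hπ hπ' h ht hc hc']
        · rw [abs_of_nonneg (S.visitProb_nonneg n π t)]
          exact (S.visitProb_le n π ht.2).trans
            (expTerm_le (NNReal.coe_nonneg _) (hπ.clock_nonneg.trans ht.1) ht.2 n)
      exact ((hS.piecewiseBounded_exitRate hπ).continuousOn_duhamel
        (hS.piecewiseBounded_jump hv hπ) 0).congr fun t ht => hS.visitProb_succ_of_tame hv hπ ht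
  · intro π hπ t ht
    rw [abs_of_nonneg (S.visitProb_nonneg n π t)]
    exact (S.visitProb_le n π ht.2).trans
      (expTerm_le (NNReal.coe_nonneg _) (hπ.clock_nonneg.trans ht.1) ht.2 n)

theorem hasSum_visitProb (S : M.Scheduler) (π : TimedPath L Act) {t : ℝ} (ht : t ≤ T) :
    HasSum (fun n => S.visitProb T n π t) (S.reachProbFrom T π t) := by
  have hs : Summable fun n => S.visitProb T n π t :=
    (summable_expTerm M.totalRate T t).of_nonneg_of_le (fun n => S.visitProb_nonneg n π t)
      fun n => S.visitProb_le n π ht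
  convert hs.hasSum using 1
  exact ENNReal.tsum_toReal_eq fun n => S.pathProb_ne_top _ n π ht

theorem CylindricalWith.tame_reachProbFrom (hS : S.CylindricalWith T J) :
    TamePathFun J T (S.reachProbFrom T) := by
  refine ⟨fun π π' hπ hπ' h t ht hc hc' => ?_, fun π hπ => ?_,
    ∑' n, expTerm M.totalRate T n 0, fun π hπ t ht => ?_⟩
  · simp only [reachProbFrom, hS.pathProb_eq M.goal _ hπ hπ' h ht hc hc']
  · refine (continuousOn_tsum (fun n => (hS.tame_visitProb n).cont π hπ)
      (summable_expTerm M.totalRate T 0) fun n t ht => ?_).congr fun t ht =>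
        (S.hasSum_visitProb π ht.2).tsum_eq.symm
    rw [Real.norm_eq_abs, abs_of_nonneg (S.visitProb_nonneg n π t)]
    exact (S.visitProb_le n π ht.2).trans
      (expTerm_le (NNReal.coe_nonneg _) (hπ.clock_nonneg.trans ht.1) ht.2 n)
  · rw [abs_of_nonneg (show 0 ≤ S.reachProbFrom T π t from ENNReal.toReal_nonneg)]
    exact hasSum_le (fun n => (S.visitProb_le n π ht.2).trans
      (expTerm_le (NNReal.coe_nonneg _) (hπ.clock_nonneg.trans ht.1) ht.2 n))
      (S.hasSum_visitProb π ht.2) (summable_expTerm M.totalRate T 0).hasSum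

/-- Sum the recursion over the number of transitions: the term without transitions gives the
terminal part, and the others give the integral, with sum and integral exchanged by dominated
convergence. -/
theorem CylindricalWith.reachProbFrom_eq (hS : S.CylindricalWith T J) {π : TimedPath L Act}
    (hπ : π.IsTimed T) {t : ℝ} (ht : t ∈ Set.Icc π.clock T) : S.reachProbFrom T π t =
      duhamel T (visited M π) (fun u => S.exitRate π u) (S.jump (S.reachProbFrom T) π) t := by
  have hE := hS.piecewiseBounded_exitRate hπ
  have hTm : T ∈ Set.Icc π.clock T := ⟨ht.1.trans ht.2, le_rfl⟩
  have hC : (0 : ℝ) ≤ M.totalRate := NNReal.coe_nonneg _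
  have h1 := (hasSum_nat_add_iff' 1).2 (S.hasSum_visitProb π ht.2)
  rw [Finset.sum_range_one, visitProb_zero] at h1
  simp only [hS.visitProb_succ_of_tame (hS.tame_visitProb _) hπ ht] at h1
  have h2 : HasSum (fun n => duhamel T 0 (fun u => S.exitRate π u)
      (S.jump (S.visitProb T n) π) t)
      (∫ s in t..T, Real.exp (-∫ u in t..s, (S.exitRate π u : ℝ)) *
        S.jump (S.reachProbFrom T) π s) := by
    simp only [duhamel, zero_mul, zero_add]
    refine intervalIntegral.hasSum_integral_of_dominated_convergence
      (fun n _ => M.totalRate * expTerm M.totalRate T n 0) (fun n => ?_) (fun n => ?_) ?_ ?_ ?_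
    · rw [Set.uIoc_of_le ht.2]
      exact (((PiecewiseBounded.of_continuousOn (hE.exp_neg_integral ht)).mul
        (hS.piecewiseBounded_jump (hS.tame_visitProb n) hπ)).intervalIntegrable ht
          hTm).1.aestronglyMeasurable
    · refine Eventually.of_forall fun s hs => ?_
      rw [Set.uIoc_of_le ht.2] at hs
      have h0 : 0 ≤ S.jump (S.visitProb T n) π s :=
        Finset.sum_nonneg fun a _ => Finset.sum_nonneg fun l' _ =>
          mul_nonneg (mul_nonneg (NNReal.coe_nonneg _) (NNReal.coe_nonneg _))
            (S.visitProb_nonneg n _ _)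
      rw [Real.norm_eq_abs, abs_of_nonneg (mul_nonneg (Real.exp_pos _).le h0)]
      refine (mul_le_of_le_one_left h0 ?_).trans (jump_le_totalRate_mul ?_ fun a l' => ?_)
      · rw [Real.exp_le_one_iff, neg_nonpos]
        exact intervalIntegral.integral_nonneg hs.1.le fun _ _ => NNReal.coe_nonneg _
      · exact expTerm_nonneg hC (hπ.clock_nonneg.trans hTm.1) n
      · exact (S.visitProb_le n _ hs.2).trans
          (expTerm_le hC (hπ.clock_nonneg.trans (ht.1.trans hs.1.le)) hs.2 n)
    · exact Eventually.of_forall fun s _ => (summable_expTerm M.totalRate T 0).mul_left _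
    · exact intervalIntegrable_const
    · refine Eventually.of_forall fun s hs => ?_
      rw [Set.uIoc_of_le ht.2] at hs
      refine HasSum.mul_left _ (hasSum_sum fun a _ => hasSum_sum fun l' _ => HasSum.mul_left _ ?_)
      exact S.hasSum_visitProb _ hs.2
  have h3 := h1.unique h2
  rw [duhamel, ← h3]
  simp [duhamel]

theorem CylindricalWith.hasDerivAt_reachProbFrom (hS : S.CylindricalWith T J)
    {π : TimedPath L Act} (hπ : π.IsTimed T) {t : ℝ}
    (ht : t ∈ Set.Ioo π.clock T \ (J : Set ℝ)) : HasDerivAt (S.reachProbFrom T π)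
      (S.exitRate π t * S.reachProbFrom T π t - S.jump (S.reachProbFrom T) π t) t := by
  have h := (hS.piecewiseBounded_exitRate hπ).hasDerivAt_duhamel
    (hS.piecewiseBounded_jump hS.tame_reachProbFrom hπ) (visited M π) ht
  rw [← hS.reachProbFrom_eq hπ ⟨ht.1.1.le, ht.1.2.le⟩] at h
  refine h.congr_of_eventuallyEq ?_
  filter_upwards [isOpen_Ioo.mem_nhds ht.1] with s hs
  exact hS.reachProbFrom_eq hπ ⟨hs.1.le, hs.2.le⟩

theorem CylindricalWith.reachProbFrom_terminal (hS : S.CylindricalWith T J)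
    {π : TimedPath L Act} (hπ : π.IsTimed T) (h : π.clock ≤ T) :
    S.reachProbFrom T π T = visited M π := by
  rw [hS.reachProbFrom_eq hπ ⟨h, le_rfl⟩]
  simp [duhamel]

theorem reachProbFrom_nonneg (S : M.Scheduler) (π : TimedPath L Act) (t : ℝ) :
    0 ≤ S.reachProbFrom T π t := ENNReal.toReal_nonneg

/-- The probability of not leaving `π` in `[t, t']` is bounded below. -/
theorem CylindricalWith.reachProbFrom_le_exp_mul (hS : S.CylindricalWith T J)
    {π : TimedPath L Act} (hπ : π.IsTimed T) {t t' : ℝ} (ht : t ∈ Set.Icc π.clock T)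
    (ht' : t' ∈ Set.Icc t T) :
    S.reachProbFrom T π t' ≤ Real.exp (M.totalRate * (t' - t)) * S.reachProbFrom T π t := by
  have hE := hS.piecewiseBounded_exitRate hπ
  have hTm : T ∈ Set.Icc π.clock T := ⟨ht.1.trans ht.2, le_rfl⟩
  have ht'm : t' ∈ Set.Icc π.clock T := ⟨ht.1.trans ht'.1, ht'.2⟩
  -- In this form the bracket can only shrink when the lower limit moves from `t` to `t'`, since
  -- `jump` is nonnegative here. What remains is the quotient of the outer exponentials, which is
  -- the exponential of the exit rate integrated over `[t, t']`.
  rw [hS.reachProbFrom_eq hπ ht, hS.reachProbFrom_eq hπ ht'm, hE.duhamel_eq _ ht,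
    hE.duhamel_eq _ ht'm, ← mul_assoc, ← Real.exp_add]
  have hjump : ∀ s, 0 ≤ S.jump (S.reachProbFrom T) π s := fun s =>
    Finset.sum_nonneg fun a _ => Finset.sum_nonneg fun l' _ =>
      mul_nonneg (mul_nonneg (NNReal.coe_nonneg _) (NNReal.coe_nonneg _))
        (S.reachProbFrom_nonneg _ _)
  have hnn : ∀ a b : ℝ, a ≤ b → 0 ≤ ∫ s in a..b,
      Real.exp (∫ u in s..T, (S.exitRate π u : ℝ)) * S.jump (S.reachProbFrom T) π s :=
    fun a b hab => intervalIntegral.integral_nonneg hab fun s _ =>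
      mul_nonneg (Real.exp_pos _).le (hjump s)
  have hq := (PiecewiseBounded.of_continuousOn hE.exp_integral).mul
    (hS.piecewiseBounded_jump hS.tame_reachProbFrom hπ)
  have hsplit := intervalIntegral.integral_add_adjacent_intervals
    (hq.intervalIntegrable ht ht'm) (hq.intervalIntegrable ht'm hTm)
  have hbound : ∫ u in t..t', (S.exitRate π u : ℝ) ≤ M.totalRate * (t' - t) := by
    have := intervalIntegral.integral_mono_on ht'.1 (hE.intervalIntegrable ht ht'm)
      (intervalIntegrable_const (c := (M.totalRate : ℝ)))
      fun u _ => NNReal.coe_le_coe.2 (S.exitRate_le π u)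
    rwa [intervalIntegral.integral_const, smul_eq_mul, mul_comm] at this
  rw [hE.integral_sub_eq ht ht'm] at hbound
  refine mul_le_mul (Real.exp_le_exp.2 (by linarith)) ?_
    (add_nonneg (visited_nonneg M π) (hnn _ _ ht'.2)) (Real.exp_pos _).le
  have := hnn t t' ht'.1
  linarith

end Scheduler

end CTMDP

/-! ### Comparison of the reachability probability with sub- and supersolutions. -/

namespace CTMDP

variable {L Act : Type*} [Fintype L] [Fintype Act] {M : CTMDP L Act}

namespace Scheduler

variable {S : M.Scheduler} {J : Finset ℝ} {T : ℝ}

/-- By linearity, `w` minus the exact solution `reachProbFrom` is a subsolution. The source `g`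
records the exact derivative of `w`, and the inequality `g ≤ jump w` carries the slack. -/
theorem CylindricalWith.le_reachProbFrom (hS : S.CylindricalWith T J)
    {w g : TimedPath L Act → ℝ → ℝ} (hw : TamePathFun J T w)
    (hT : ∀ π : TimedPath L Act, π.IsTimed T → π.clock ≤ T → w π T ≤ visited M π)
    (hg : ∀ π : TimedPath L Act, π.IsTimed T → PiecewiseBounded J π.clock T (g π))
    (hderiv : ∀ π : TimedPath L Act, π.IsTimed T →
      ∀ t ∈ Set.Ioo π.clock T \ (J : Set ℝ), HasDerivAt (w π) (S.exitRate π t * w π t - g π t) t)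
    (hle : ∀ π : TimedPath L Act, π.IsTimed T → ∀ t ∈ Set.Icc π.clock T, g π t ≤ S.jump w π t)
    {π : TimedPath L Act} (hπ : π.IsTimed T) {t : ℝ} (ht : t ∈ Set.Icc π.clock T) :
    w π t ≤ S.reachProbFrom T π t := by
  refine sub_nonpos.1 (hS.nonpos_of_subsolution
    (q := fun π s => g π s - S.jump (S.reachProbFrom T) π s)
    (hw.sub hS.tame_reachProbFrom) ?_ ?_ ?_ ?_ hπ ht)
  · intro π hπ h
    rw [hS.reachProbFrom_terminal hπ h]
    exact sub_nonpos.2 (hT π hπ h)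
  · exact fun π hπ => (hg π hπ).sub (hS.piecewiseBounded_jump hS.tame_reachProbFrom hπ)
  · intro π hπ t ht
    exact ((hderiv π hπ t ht).sub (hS.hasDerivAt_reachProbFrom hπ ht)).congr_deriv (by ring)
  · intro π hπ t ht
    rw [S.jump_sub]
    exact sub_le_sub_right (hle π hπ t ht) _

theorem CylindricalWith.reachProbFrom_le (hS : S.CylindricalWith T J)
    {w g : TimedPath L Act → ℝ → ℝ} (hw : TamePathFun J T w)
    (hT : ∀ π : TimedPath L Act, π.IsTimed T → π.clock ≤ T → visited M π ≤ w π T)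
    (hg : ∀ π : TimedPath L Act, π.IsTimed T → PiecewiseBounded J π.clock T (g π))
    (hderiv : ∀ π : TimedPath L Act, π.IsTimed T →
      ∀ t ∈ Set.Ioo π.clock T \ (J : Set ℝ), HasDerivAt (w π) (S.exitRate π t * w π t - g π t) t)
    (hle : ∀ π : TimedPath L Act, π.IsTimed T → ∀ t ∈ Set.Icc π.clock T, S.jump w π t ≤ g π t)
    {π : TimedPath L Act} (hπ : π.IsTimed T) {t : ℝ} (ht : t ∈ Set.Icc π.clock T) :
    S.reachProbFrom T π t ≤ w π t := by
  refine sub_nonpos.1 (hS.nonpos_of_subsolution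
    (q := fun π s => S.jump (S.reachProbFrom T) π s - g π s)
    (hS.tame_reachProbFrom.sub hw) ?_ ?_ ?_ ?_ hπ ht)
  · intro π hπ h
    rw [hS.reachProbFrom_terminal hπ h]
    exact sub_nonpos.2 (hT π hπ h)
  · exact fun π hπ => (hS.piecewiseBounded_jump hS.tame_reachProbFrom hπ).sub (hg π hπ)
  · intro π hπ t ht
    exact ((hS.hasDerivAt_reachProbFrom hπ ht).sub (hderiv π hπ t ht)).congr_deriv (by ring)
  · intro π hπ t ht
    rw [S.jump_sub]
    exact sub_le_sub_left (hle π hπ t ht) _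

/-- The constant `1` solves the backward equation exactly and dominates the terminal values. -/
theorem CylindricalWith.reachProbFrom_le_one (hS : S.CylindricalWith T J) {π : TimedPath L Act}
    (hπ : π.IsTimed T) {t : ℝ} (ht : t ∈ Set.Icc π.clock T) : S.reachProbFrom T π t ≤ 1 := by
  refine hS.reachProbFrom_le (w := fun _ _ => 1) (g := fun π s => S.exitRate π s)
    (TamePathFun.const 1) (fun π _ _ => visited_le_one M π)
    (fun π hπ => hS.piecewiseBounded_exitRate hπ) ?_ ?_ hπ ht
  · intro π _ t _
    simpa using hasDerivAt_const t (1 : ℝ)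
  · intro π _ t _
    rw [S.jump_const, mul_one]

/-! ### The solutions of the differential equations as bounds -/

open Classical in
/-- The value of a path, if `f` is the value of its last location before the goal is visited. -/
noncomputable def valueFrom (M : CTMDP L Act) (f : L → ℝ → ℝ) (π : TimedPath L Act) (t : ℝ) : ℝ :=
  if π.Visits M.goal then 1 else f π.last t

theorem valueFrom_of_visits {f : L → ℝ → ℝ} {π : TimedPath L Act} (h : π.Visits M.goal) :
    valueFrom M f π = fun _ => 1 := funext fun _ => if_pos h

theorem valueFrom_of_not_visits {f : L → ℝ → ℝ} {π : TimedPath L Act} (h : ¬ π.Visits M.goal) :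
    valueFrom M f π = f π.last := funext fun _ => if_neg h

theorem valueFrom_start {f : L → ℝ → ℝ} (hf : M.BoundaryConditions T f) (l : L) {t : ℝ}
    (ht : t ∈ Set.Icc 0 T) : valueFrom M f (.start l) t = f l t := by
  by_cases h : l ∈ M.goal
  · rw [valueFrom_of_visits (show (TimedPath.start l).Visits M.goal from h), hf.1 l h t ht]
  · rw [valueFrom_of_not_visits (show ¬ (TimedPath.start l).Visits M.goal from h)]
    rfl

theorem tame_valueFrom {f : L → ℝ → ℝ} (hf : ∀ l, ContinuousOn (f l) (Set.Icc 0 T)) :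
    TamePathFun J T (valueFrom M f) := by
  choose K hK using fun l => isCompact_Icc.exists_bound_of_continuousOn (hf l)
  refine ⟨fun π π' _ _ h t _ _ _ => ?_, fun π hπ => ?_, 1 + ∑ l, |K l|, fun π hπ t ht => ?_⟩
  · by_cases hv : π.Visits M.goal
    · rw [valueFrom_of_visits hv, valueFrom_of_visits (h.visits_iff.1 hv)]
    · rw [valueFrom_of_not_visits hv, valueFrom_of_not_visits (mt h.visits_iff.2 hv), h.last_eq]
  · by_cases hv : π.Visits M.goal
    · rw [valueFrom_of_visits hv]
      exact continuousOn_const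
    · rw [valueFrom_of_not_visits hv]
      exact (hf _).mono (Set.Icc_subset_Icc_left hπ.clock_nonneg)
  · have hsum : 0 ≤ ∑ l, |K l| := Finset.sum_nonneg fun _ _ => abs_nonneg _
    by_cases hv : π.Visits M.goal
    · rw [valueFrom_of_visits hv, abs_one]
      linarith
    · rw [valueFrom_of_not_visits hv]
      have h1 : |f π.last t| ≤ K π.last := hK π.last t ⟨hπ.clock_nonneg.trans ht.1, ht.2⟩
      have h2 : |K π.last| ≤ ∑ l, |K l| :=
        Finset.single_le_sum (f := fun l => |K l|) (fun _ _ => abs_nonneg _) (Finset.mem_univ _)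
      linarith [le_abs_self (K π.last)]

/-- Before the goal is visited, the generator applied to `valueFrom M f` is the averaged drift. -/
theorem jump_valueFrom {f : L → ℝ → ℝ} (hf : M.BoundaryConditions T f) (S : M.Scheduler)
    {π : TimedPath L Act} (hv : ¬ π.Visits M.goal) {s : ℝ} (hs : s ∈ Set.Icc 0 T) :
    S.jump (valueFrom M f) π s = S.exitRate π s * valueFrom M f π s +
      ∑ a, (S.prob π s a : ℝ) * M.drift (fun l' => f l' s) π.last a := by
  have hstep : ∀ a l', valueFrom M f (π.step a s l') s = f l' s := by
    intro a l'
    by_cases h : l' ∈ M.goal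
    · rw [valueFrom_of_visits (show (π.step a s l').Visits M.goal from Or.inr h), hf.1 l' h s hs]
    · rw [valueFrom_of_not_visits
        (show ¬ (π.step a s l').Visits M.goal from fun h' => h'.elim hv h)]
      rfl
  rw [valueFrom_of_not_visits hv, ← S.sum_real_rates]
  simp only [jump, hstep, drift, Finset.sum_mul, Finset.mul_sum, ← Finset.sum_add_distrib]
  exact Finset.sum_congr rfl fun a _ => Finset.sum_congr rfl fun l' _ => by ring

theorem jump_valueFrom_of_visits {f : L → ℝ → ℝ} (S : M.Scheduler)
    {π : TimedPath L Act} (hv : π.Visits M.goal) (s : ℝ) :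
    S.jump (valueFrom M f) π s = S.exitRate π s := by
  have hstep : ∀ a l', valueFrom M f (π.step a s l') s = 1 := fun a l' =>
    congrFun (valueFrom_of_visits (show (π.step a s l').Visits M.goal from Or.inl hv)) s
  simp only [jump, hstep, mul_one, S.sum_real_rates]

open Classical in
/-- The rate of decrease of `valueFrom M f` if `φ` is that of `f`. -/
noncomputable def decreaseFrom (M : CTMDP L Act) (φ : L → ℝ → ℝ) (π : TimedPath L Act) (t : ℝ) :
    ℝ :=
  if π.Visits M.goal then 0 else φ π.last t

theorem piecewiseBounded_decreaseFrom {φ : L → ℝ → ℝ}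
    (hφ : ∀ l, ContinuousOn (φ l) (Set.Icc 0 T)) {π : TimedPath L Act} (hπ : π.IsTimed T) :
    PiecewiseBounded J π.clock T (decreaseFrom M φ π) := by
  unfold decreaseFrom
  split_ifs
  · exact PiecewiseBounded.const 0
  · exact PiecewiseBounded.of_continuousOn
      ((hφ _).mono (Set.Icc_subset_Icc_left hπ.clock_nonneg))

theorem hasDerivAt_valueFrom {f φ : L → ℝ → ℝ}
    (hf : ∀ l, ∀ t ∈ Set.Icc 0 T, HasDerivWithinAt (f l) (-φ l t) (Set.Icc 0 T) t)
    {π : TimedPath L Act} (hπ : π.IsTimed T) {t : ℝ} (ht : t ∈ Set.Ioo π.clock T) :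
    HasDerivAt (valueFrom M f π) (-decreaseFrom M φ π t) t := by
  by_cases hv : π.Visits M.goal
  · rw [valueFrom_of_visits hv, decreaseFrom, if_pos hv, neg_zero]
    exact hasDerivAt_const _ _
  · have h0 : 0 < t := hπ.clock_nonneg.trans_lt ht.1
    rw [valueFrom_of_not_visits hv, decreaseFrom, if_neg hv]
    exact (hf _ t ⟨h0.le, ht.2.le⟩).hasDerivAt (Icc_mem_nhds h0 ht.2)

theorem valueFrom_terminal {f : L → ℝ → ℝ} (hf : M.BoundaryConditions T f)
    (π : TimedPath L Act) : valueFrom M f π T = visited M π := by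
  by_cases hv : π.Visits M.goal
  · rw [valueFrom_of_visits hv, visited_of_visits hv]
  · rw [valueFrom_of_not_visits hv, visited_of_not_visits hv]
    exact hf.2 _ (mt TimedPath.visits_of_last_mem hv)

/-- The scheduler puts mass only on enabled actions, so its averaged drift is at most `φ` and
`valueFrom M f` is a supersolution. After a visit to the goal it is constantly `1`, and equality
holds. -/
theorem CylindricalWith.reachProb_le_of_drift_le (hS : S.CylindricalWith T J) {f φ : L → ℝ → ℝ}
    (hf : M.BoundaryConditions T f)
    (hderiv : ∀ l, ∀ t ∈ Set.Icc 0 T, HasDerivWithinAt (f l) (-φ l t) (Set.Icc 0 T) t)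
    (hφ : ∀ l, ContinuousOn (φ l) (Set.Icc 0 T))
    (hdrift : ∀ l, ∀ t ∈ Set.Icc 0 T, ∀ a ∈ M.enabled l, M.drift (fun l' => f l' t) l a ≤ φ l t)
    (l : L) {t : ℝ} (ht : t ∈ Set.Icc 0 T) : S.reachProb T l t ≤ f l t := by
  rw [← valueFrom_start hf l ht]
  refine hS.reachProbFrom_le
    (g := fun π s => S.exitRate π s * valueFrom M f π s + decreaseFrom M φ π s)
    (tame_valueFrom fun l t ht => (hderiv l t ht).continuousWithinAt)
    (fun π _ _ => (valueFrom_terminal hf π).ge)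
    (fun π hπ => ((hS.piecewiseBounded_exitRate hπ).mul ((tame_valueFrom
      fun l t ht => (hderiv l t ht).continuousWithinAt).piecewiseBounded hπ)).add
        (piecewiseBounded_decreaseFrom hφ hπ))
    (fun π hπ t ht => (hasDerivAt_valueFrom hderiv hπ ht.1).congr_deriv (by ring)) ?_
    (π := .start l) trivial ht
  intro π hπ s hs
  by_cases hv : π.Visits M.goal
  · rw [jump_valueFrom_of_visits S hv, valueFrom_of_visits hv, decreaseFrom, if_pos hv, mul_one,
      add_zero]
  · have hs0 : s ∈ Set.Icc 0 T := ⟨hπ.clock_nonneg.trans hs.1, hs.2⟩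
    rw [jump_valueFrom hf S hv hs0, decreaseFrom, if_neg hv]
    refine add_le_add_right ?_ _
    have hsum : ∑ a, (S.prob π s a : ℝ) = 1 := by exact_mod_cast S.sum_eq_one π s
    rw [← one_mul (φ _ _), ← hsum, Finset.sum_mul]
    refine Finset.sum_le_sum fun a _ => ?_
    by_cases ha : S.prob π s a = 0
    · simp [ha]
    · exact mul_le_mul_of_nonneg_left
        (hdrift _ s hs0 a (S.enabled_of_ne_zero π s a ha)) (NNReal.coe_nonneg _)

theorem CylindricalWith.le_reachProb_of_le_drift (hS : S.CylindricalWith T J) {f φ : L → ℝ → ℝ}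
    (hf : M.BoundaryConditions T f)
    (hderiv : ∀ l, ∀ t ∈ Set.Icc 0 T, HasDerivWithinAt (f l) (-φ l t) (Set.Icc 0 T) t)
    (hφ : ∀ l, ContinuousOn (φ l) (Set.Icc 0 T))
    (hdrift : ∀ l, ∀ t ∈ Set.Icc 0 T, ∀ a ∈ M.enabled l, φ l t ≤ M.drift (fun l' => f l' t) l a)
    (l : L) {t : ℝ} (ht : t ∈ Set.Icc 0 T) : f l t ≤ S.reachProb T l t := by
  rw [← valueFrom_start hf l ht]
  refine hS.le_reachProbFrom
    (g := fun π s => S.exitRate π s * valueFrom M f π s + decreaseFrom M φ π s)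
    (tame_valueFrom fun l t ht => (hderiv l t ht).continuousWithinAt)
    (fun π _ _ => (valueFrom_terminal hf π).le)
    (fun π hπ => ((hS.piecewiseBounded_exitRate hπ).mul ((tame_valueFrom
      fun l t ht => (hderiv l t ht).continuousWithinAt).piecewiseBounded hπ)).add
        (piecewiseBounded_decreaseFrom hφ hπ))
    (fun π hπ t ht => (hasDerivAt_valueFrom hderiv hπ ht.1).congr_deriv (by ring)) ?_
    (π := .start l) trivial ht
  intro π hπ s hs
  by_cases hv : π.Visits M.goal
  · rw [jump_valueFrom_of_visits S hv, valueFrom_of_visits hv, decreaseFrom, if_pos hv, mul_one,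
      add_zero]
  · have hs0 : s ∈ Set.Icc 0 T := ⟨hπ.clock_nonneg.trans hs.1, hs.2⟩
    rw [jump_valueFrom hf S hv hs0, decreaseFrom, if_neg hv]
    refine add_le_add_right ?_ _
    have hsum : ∑ a, (S.prob π s a : ℝ) = 1 := by exact_mod_cast S.sum_eq_one π s
    rw [← one_mul (φ _ _), ← hsum, Finset.sum_mul]
    refine Finset.sum_le_sum fun a _ => ?_
    by_cases ha : S.prob π s a = 0
    · simp [ha]
    · exact mul_le_mul_of_nonneg_left
        (hdrift _ s hs0 a (S.enabled_of_ne_zero π s a ha)) (NNReal.coe_nonneg _)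

theorem continuousOn_drift {f : L → ℝ → ℝ} {s : Set ℝ} (hf : ∀ l, ContinuousOn (f l) s) (l : L)
    (a : Act) : ContinuousOn (fun t => M.drift (fun l' => f l' t) l a) s :=
  continuousOn_finsetSum _ fun l' _ => continuousOn_const.mul ((hf l').sub (hf l))

theorem CylindricalWith.reachProb_le_fmax (hS : S.CylindricalWith T J) {f : L → ℝ → ℝ}
    (hf : M.IsFMax T f) (l : L) {t : ℝ} (ht : t ∈ Set.Icc 0 T) : S.reachProb T l t ≤ f l t :=
  hS.reachProb_le_of_drift_le
    (φ := fun l t => (M.enabled l).sup' (M.enabled_nonempty l) (M.drift (fun l' => f l' t) l))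
    hf.1 hf.2
    (fun l => ContinuousOn.finset_sup'_apply (M.enabled_nonempty l) fun a _ =>
      continuousOn_drift (fun l t ht => (hf.2 l t ht).continuousWithinAt) l a)
    (fun _ _ _ _ ha => Finset.le_sup' _ ha) l ht

theorem CylindricalWith.fmin_le_reachProb (hS : S.CylindricalWith T J) {f : L → ℝ → ℝ}
    (hf : M.IsFMin T f) (l : L) {t : ℝ} (ht : t ∈ Set.Icc 0 T) : f l t ≤ S.reachProb T l t :=
  hS.le_reachProb_of_le_drift
    (φ := fun l t => (M.enabled l).inf' (M.enabled_nonempty l) (M.drift (fun l' => f l' t) l))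
    hf.1 hf.2
    (fun l => ContinuousOn.finset_inf'_apply (M.enabled_nonempty l) fun a _ =>
      continuousOn_drift (fun l t ht => (hf.2 l t ht).continuousWithinAt) l a)
    (fun _ _ _ _ ha => Finset.inf'_le _ ha) l ht

end Scheduler

end CTMDP

namespace CTMDP

variable {L Act : Type*} [Fintype L] [Fintype Act] {M : CTMDP L Act}

/-! ### The difference process -/

theorem exitRate_le_of_surplusAction {l : L} {p q : Act → ℝ≥0} {a c : Act}
    (h : M.surplusAction l p q = some a) (hc : q c < p c) :
    M.exitRate l c ≤ M.exitRate l a := by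
  classical
  unfold surplusAction at h
  split_ifs at h with hn
  have := (Finset.exists_max_image _ (M.exitRate l) hn).choose_spec.2 c (by simpa using hc)
  rwa [Option.some.inj h] at this

/-- The mass of `p` beyond the common part sits on actions with `q < p`, and `a` has the largest
exit rate among these. -/
theorem sum_mul_exitRate_le_of_surplusAction {l : L} {p q : Act → ℝ≥0} {a : Act}
    (hp : ∑ a, p a = 1) (h : M.surplusAction l p q = some a) :
    ∑ c, p c * M.exitRate l c ≤ ∑ c, min (p c) (q c) * M.exitRate l c +
      (1 - ∑ c, min (p c) (q c)) * M.exitRate l a := by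
  have hsplit : ∑ c, (p c - min (p c) (q c)) = 1 - ∑ c, min (p c) (q c) := by
    refine eq_tsub_of_add_eq ?_
    rw [← Finset.sum_add_distrib, ← hp]
    exact Finset.sum_congr rfl fun c _ => tsub_add_cancel_of_le (min_le_left _ _)
  rw [← hsplit, Finset.sum_mul, ← Finset.sum_add_distrib]
  refine Finset.sum_le_sum fun c _ => ?_
  rcases le_or_gt (p c) (q c) with hc | hc
  · simp [min_eq_left hc]
  · calc p c * M.exitRate l c
        = min (p c) (q c) * M.exitRate l c + (p c - min (p c) (q c)) * M.exitRate l c := by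
          rw [← add_mul, add_tsub_cancel_of_le (min_le_left _ _)]
      _ ≤ _ := by
          gcongr
          exact exitRate_le_of_surplusAction h hc

/-- The rate at which the difference process enters the fresh goal location. -/
noncomputable def freshRate (M : CTMDP L Act) (l : L) (p q : Act → ℝ≥0) : ℝ≥0 :=
  ∑ a, ∑ b, M.diffDecision l p q (some (.inr (a, b))) * (M.exitRate l a + M.exitRate l b)

/-- The fresh action has the sum of the two surplus exit rates, so a single rate covers what either
scheduler loses in passing to the common part. Both inequalities are needed in `reachGap_le`. -/
theorem sum_mul_exitRate_le_freshRate {l : L} {p q : Act → ℝ≥0}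
    (hp : ∑ a, p a = 1) (hq : ∑ a, q a = 1) :
    ∑ c, p c * M.exitRate l c ≤
        ∑ c, min (p c) (q c) * M.exitRate l c + M.freshRate l p q ∧
      ∑ c, q c * M.exitRate l c ≤
        ∑ c, min (p c) (q c) * M.exitRate l c + M.freshRate l p q := by
  rcases h₁ : M.surplusAction l p q with _ | a
  · obtain rfl := eq_of_surplusAction_eq_none hp hq h₁
    simp
  rcases h₂ : M.surplusAction l q p with _ | b
  · obtain rfl := eq_of_surplusAction_eq_none hq hp h₂
    simp
  have hF : (1 - ∑ c, min (p c) (q c)) * (M.exitRate l a + M.exitRate l b) ≤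
      M.freshRate l p q := by
    calc _ = M.diffDecision l p q (some (.inr (a, b))) * (M.exitRate l a + M.exitRate l b) := by
          simp [diffDecision, h₁, h₂]
      _ ≤ ∑ b', M.diffDecision l p q (some (.inr (a, b'))) *
            (M.exitRate l a + M.exitRate l b') :=
          Finset.single_le_sum (f := fun b' => M.diffDecision l p q (some (.inr (a, b'))) *
            (M.exitRate l a + M.exitRate l b')) (fun _ _ => zero_le) (Finset.mem_univ b)
      _ ≤ _ := Finset.single_le_sum (f := fun a' => ∑ b',
            M.diffDecision l p q (some (.inr (a', b'))) *
            (M.exitRate l a' + M.exitRate l b')) (fun _ _ => zero_le) (Finset.mem_univ a)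
  constructor
  · refine (sum_mul_exitRate_le_of_surplusAction hp h₁).trans (add_le_add_right ?_ _)
    refine le_trans ?_ hF
    gcongr
    exact le_self_add
  · have h := sum_mul_exitRate_le_of_surplusAction hq h₂
    simp only [min_comm (q _) (p _)] at h
    refine h.trans (add_le_add_right ?_ _)
    refine le_trans ?_ hF
    gcongr
    exact le_add_self

variable {J : Finset ℝ} {T : ℝ}

theorem clock_of_oldPath {L Act : Type*} {π : TimedPath (Option L) (DiffAct Act)} {ρ : TimedPath L Act}
    (h : oldPath π = some ρ) : ρ.clock = π.clock := by
  rcases π with (_ | l) | ⟨π, (_ | a | a), t, (_ | l)⟩ <;> simp [oldPath] at h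
  · subst h; rfl
  · obtain ⟨σ, _, rfl⟩ := h; rfl

theorem isTimed_of_oldPath {L Act : Type*} : ∀ {π : TimedPath (Option L) (DiffAct Act)}
    {ρ : TimedPath L Act}, oldPath π = some ρ → π.IsTimed T → ρ.IsTimed T
  | .start (some l), ρ, h, _ => by
    simp only [oldPath, Option.some.injEq] at h
    subst h
    trivial
  | .step π (some (.inl a)) t (some l), ρ, h, hπ => by
    simp only [oldPath, Option.map_eq_some_iff] at h
    obtain ⟨σ, hσ, rfl⟩ := h
    exact ⟨isTimed_of_oldPath hσ hπ.1, (clock_of_oldPath hσ).trans_le hπ.2.1, hπ.2.2⟩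

theorem not_visits_of_oldPath {L Act : Type*} : ∀ {π : TimedPath (Option L) (DiffAct Act)}
    {ρ : TimedPath L Act}, oldPath π = some ρ → ¬ π.Visits {none}
  | .start (some l), ρ, h, hv => by cases (show some l = none from hv)
  | .step π (some (.inl a)) t (some l), ρ, h, hv => by
    simp only [oldPath, Option.map_eq_some_iff] at h
    obtain ⟨σ, hσ, rfl⟩ := h
    rcases hv with hv | hv
    · exact not_visits_of_oldPath hσ hv
    · cases (show some l = none from hv)

theorem oldPath_sameCylinder {L Act : Type*} : ∀ {π π' : TimedPath (Option L) (DiffAct Act)},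
    TimedPath.SameCylinder J π π' → (oldPath π = none ∧ oldPath π' = none) ∨
      ∃ ρ ρ', oldPath π = some ρ ∧ oldPath π' = some ρ' ∧ TimedPath.SameCylinder J ρ ρ'
  | .start none, .start _, h => by cases (h : _ = _); exact Or.inl ⟨rfl, rfl⟩
  | .start (some l), .start _, h => by
    cases (h : _ = _); exact Or.inr ⟨_, _, rfl, rfl, TimedPath.SameCylinder.refl _⟩
  | .step π a t l, .step π' a' t' l', h => by
    obtain ⟨h, rfl, ht, rfl⟩ := h
    rcases a with _ | a | a
    · exact Or.inl ⟨rfl, rfl⟩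
    · rcases l with _ | l
      · exact Or.inl ⟨rfl, rfl⟩
      · rcases oldPath_sameCylinder h with ⟨h₁, h₂⟩ | ⟨ρ, ρ', h₁, h₂, h₃⟩
        · left
          simp [oldPath, h₁, h₂]
        · right
          exact ⟨ρ.step a t l, ρ'.step a t' l, by simp [oldPath, h₁], by simp [oldPath, h₂],
            h₃, rfl, ht, rfl⟩
    · exact Or.inl ⟨rfl, rfl⟩

theorem oldPath_step_eq_none {L Act : Type*} {π : TimedPath (Option L) (DiffAct Act)}
    (h : oldPath π = none) (x : DiffAct Act) (t : ℝ) (l : Option L) :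
    oldPath (π.step x t l) = none := by
  rcases x with _ | a | a <;> rcases l with _ | l <;> simp [oldPath, h]

namespace Scheduler

variable {D E : M.Scheduler}

theorem diff_prob_of_oldPath (D E : M.Scheduler) {π : TimedPath (Option L) (DiffAct Act)}
    {ρ : TimedPath L Act} (h : oldPath π = some ρ) (t : ℝ) :
    (D.diff E).prob π t = M.diffDecision ρ.last (D.prob ρ t) (E.prob ρ t) := by
  funext x
  simp only [Scheduler.diff, h]

theorem CylindricalWith.diff (hD : D.CylindricalWith T J) (hE : E.CylindricalWith T J) :
    (D.diff E).CylindricalWith T J := by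
  intro π π' t ht t' ht' hπ hπ' h hcell
  rcases oldPath_sameCylinder h with ⟨h₁, h₂⟩ | ⟨ρ, ρ', h₁, h₂, h₃⟩
  · funext x
    have hl : ∀ l l' : Option L, l = l' → (M.diff.exists_enabled l).choose =
        (M.diff.exists_enabled l').choose := by
      rintro l _ rfl
      rfl
    simp only [Scheduler.diff, h₁, h₂]
    rw [hl _ _ h.last_eq]
  · have hρ := isTimed_of_oldPath h₁ hπ
    have hρ' := isTimed_of_oldPath h₂ hπ'
    rw [diff_prob_of_oldPath D E h₁, diff_prob_of_oldPath D E h₂, h₃.last_eq,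
      hD ρ ρ' t ht t' ht' hρ hρ' h₃ hcell, hE ρ ρ' t ht t' ht' hρ hρ' h₃ hcell]

/-- On paths with old actions only, the difference of the reachability probabilities of `D` and
`E`; on the other paths, the indicator of having reached the fresh goal location. -/
noncomputable def reachGap (D E : M.Scheduler) (T : ℝ)
    (π : TimedPath (Option L) (DiffAct Act)) (t : ℝ) : ℝ :=
  match oldPath π with
  | some ρ => D.reachProbFrom T ρ t - E.reachProbFrom T ρ t
  | none => visited M.diff π

theorem reachGap_of_some (D E : M.Scheduler) {π : TimedPath (Option L) (DiffAct Act)}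
    {ρ : TimedPath L Act} (h : oldPath π = some ρ) :
    reachGap D E T π = fun t => D.reachProbFrom T ρ t - E.reachProbFrom T ρ t := by
  funext t
  simp only [reachGap, h]

theorem reachGap_of_none (D E : M.Scheduler) {π : TimedPath (Option L) (DiffAct Act)}
    (h : oldPath π = none) : reachGap D E T π = fun _ => visited M.diff π := by
  funext t
  simp only [reachGap, h]

theorem CylindricalWith.tame_reachGap (hD : D.CylindricalWith T J) (hE : E.CylindricalWith T J) :
    TamePathFun J T (reachGap D E T) := by
  have hs := hD.tame_reachProbFrom.sub hE.tame_reachProbFrom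
  have hvis : TamePathFun J T fun π (_ : ℝ) => visited M.diff π := tame_visited M.diff
  obtain ⟨K, hK⟩ := hs.bdd
  refine ⟨fun π π' hπ hπ' h t ht hc hc' => ?_, fun π hπ => ?_, max K 1, fun π hπ t ht => ?_⟩
  · rcases oldPath_sameCylinder h with ⟨h₁, h₂⟩ | ⟨ρ, ρ', h₁, h₂, h₃⟩
    · rw [reachGap_of_none D E h₁, reachGap_of_none D E h₂]
      exact hvis.inv π π' hπ hπ' h t ht hc hc'
    · rw [reachGap_of_some D E h₁, reachGap_of_some D E h₂]
      exact hs.inv ρ ρ' (isTimed_of_oldPath h₁ hπ) (isTimed_of_oldPath h₂ hπ') h₃ t ht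
        ((clock_of_oldPath h₁).trans_le hc) ((clock_of_oldPath h₂).trans_le hc')
  · rcases h : oldPath π with _ | ρ
    · rw [reachGap_of_none D E h]
      exact continuousOn_const
    · rw [reachGap_of_some D E h, ← clock_of_oldPath h]
      exact hs.cont ρ (isTimed_of_oldPath h hπ)
  · rcases h : oldPath π with _ | ρ
    · rw [reachGap_of_none D E h, abs_of_nonneg (visited_nonneg _ _)]
      exact (visited_le_one _ _).trans (le_max_right _ _)
    · rw [reachGap_of_some D E h]
      rw [← clock_of_oldPath h] at ht
      exact (hK ρ (isTimed_of_oldPath h hπ) t ht).trans (le_max_left _ _)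

/-- The jump operator of the difference process on a path with old actions only. -/
theorem jump_diff_of_oldPath (D E : M.Scheduler) {π : TimedPath (Option L) (DiffAct Act)}
    {ρ : TimedPath L Act} (h : oldPath π = some ρ) (s : ℝ)
    {w : TimedPath (Option L) (DiffAct Act) → ℝ → ℝ} {r : ℝ}
    (hr : ∀ ab, w (π.step (some (.inr ab)) s none) s = r) :
    (D.diff E).jump w π s =
      ∑ a, ∑ l', (min (D.prob ρ s a) (E.prob ρ s a) : ℝ) * M.rate ρ.last a l' *
        w (π.step (some (.inl a)) s (some l')) s +
      M.freshRate ρ.last (D.prob ρ s) (E.prob ρ s) * r := by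
  simp only [jump, diff_prob_of_oldPath D E h, last_of_oldPath h, CTMDP.diff, Fintype.sum_option,
    Fintype.sum_sum_type, Fintype.sum_prod_type, diffRate, hr, freshRate]
  simp only [show ∀ l p q, M.diffDecision l p q none = 0 from fun _ _ _ => rfl,
    show ∀ l p q a, M.diffDecision l p q (some (.inl a)) = min (p a) (q a) from
      fun _ _ _ _ => rfl]
  simp [Finset.sum_mul]

theorem exitRate_diff_of_oldPath (D E : M.Scheduler) {π : TimedPath (Option L) (DiffAct Act)}
    {ρ : TimedPath L Act} (h : oldPath π = some ρ) (s : ℝ) :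
    ((D.diff E).exitRate π s : ℝ) =
      ((∑ a, min (D.prob ρ s a) (E.prob ρ s a) * M.exitRate ρ.last a +
        M.freshRate ρ.last (D.prob ρ s) (E.prob ρ s) : ℝ≥0) : ℝ) := by
  -- The exit rate is `jump` applied to the constant `1`.
  have h1 := (D.diff E).jump_const 1 π s
  rw [jump_diff_of_oldPath D E h s (r := 1) fun _ => rfl] at h1
  rw [← mul_one ((D.diff E).exitRate π s : ℝ), ← h1]
  simp [CTMDP.exitRate, Finset.mul_sum]

/-- The difference of the reachability probabilities is bounded by the probability that the
difference process reaches its goal. -/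
theorem CylindricalWith.reachGap_le (hD : D.CylindricalWith T J) (hE : E.CylindricalWith T J)
    {π : TimedPath (Option L) (DiffAct Act)} (hπ : π.IsTimed T) {t : ℝ}
    (ht : t ∈ Set.Icc π.clock T) : reachGap D E T π t ≤ (D.diff E).reachProbFrom T π t := by
  have hDE := hD.diff hE
  let u := D.reachProbFrom T
  let v := E.reachProbFrom T
  -- The `match` is the time derivative of `reachGap`, so the required differential equation holds
  -- by construction.
  let g : TimedPath (Option L) (DiffAct Act) → ℝ → ℝ := fun π s =>
    (D.diff E).exitRate π s * reachGap D E T π s - (match oldPath π with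
      | some ρ => (D.exitRate ρ s * u ρ s - D.jump u ρ s) - (E.exitRate ρ s * v ρ s - E.jump v ρ s)
      | none => 0)
  refine hDE.le_reachProbFrom (g := g) (hD.tame_reachGap hE) ?_ ?_ ?_ ?_ hπ ht
  · intro π hπ hc
    rcases h : oldPath π with _ | ρ
    · rw [reachGap_of_none D E h]
    · have hρ := isTimed_of_oldPath h hπ
      have hcρ : ρ.clock ≤ T := (clock_of_oldPath h).trans_le hc
      rw [reachGap_of_some D E h]
      simp only [hD.reachProbFrom_terminal hρ hcρ, hE.reachProbFrom_terminal hρ hcρ, sub_self]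
      exact visited_nonneg _ _
  · intro π hπ
    refine ((hDE.piecewiseBounded_exitRate hπ).mul
      ((hD.tame_reachGap hE).piecewiseBounded hπ)).sub ?_
    rcases h : oldPath π with _ | ρ
    · exact PiecewiseBounded.const 0
    · have hρ := isTimed_of_oldPath h hπ
      rw [← clock_of_oldPath h]
      exact (((hD.piecewiseBounded_exitRate hρ).mul
        (hD.tame_reachProbFrom.piecewiseBounded hρ)).sub
          (hD.piecewiseBounded_jump hD.tame_reachProbFrom hρ)).sub
        (((hE.piecewiseBounded_exitRate hρ).mul
        (hE.tame_reachProbFrom.piecewiseBounded hρ)).sub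
          (hE.piecewiseBounded_jump hE.tame_reachProbFrom hρ))
  · intro π hπ t ht
    simp only [g, sub_sub_cancel]
    rcases h : oldPath π with _ | ρ
    · rw [reachGap_of_none D E h]
      exact hasDerivAt_const _ _
    · have hρ := isTimed_of_oldPath h hπ
      rw [← clock_of_oldPath h] at ht
      rw [reachGap_of_some D E h]
      exact (hD.hasDerivAt_reachProbFrom hρ ht).sub (hE.hasDerivAt_reachProbFrom hρ ht)
  · intro π hπ s hs
    rcases h : oldPath π with _ | ρ
    · simp only [g, h, sub_zero]
      rw [reachGap_of_none D E h, ← (D.diff E).jump_const]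
      -- On these histories the gap is the indicator of a past visit, which cannot decrease along a
      -- path.
      refine jump_mono fun x l' => ?_
      rw [reachGap_of_none D E (oldPath_step_eq_none h x s l')]
      by_cases hv : π.Visits M.diff.goal
      · rw [visited_of_visits (π := π.step x s l') (Or.inl hv)]
        exact visited_le_one _ _
      · rw [visited_of_not_visits hv]
        exact visited_nonneg _ _
    · have hρ := isTimed_of_oldPath h hπ
      have hsρ : s ∈ Set.Icc ρ.clock T := by rwa [clock_of_oldPath h]
      have hfresh : ∀ ab, reachGap D E T (π.step (some (.inr ab)) s none) s = 1 := by
        intro ab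
        rw [reachGap_of_none D E (by simp [oldPath])]
        exact visited_of_visits (Or.inr rfl)
      have hold : ∀ a l', reachGap D E T (π.step (some (.inl a)) s (some l')) s =
          u (ρ.step a s l') s - v (ρ.step a s l') s := by
        intro a l'
        rw [reachGap_of_some D E (ρ := ρ.step a s l') (by simp [oldPath, h])]
      simp only [g, h]
      rw [reachGap_of_some D E h, jump_diff_of_oldPath D E h s hfresh,
        exitRate_diff_of_oldPath D E h]
      simp only [hold, mul_one]
      have hbounds := sum_mul_exitRate_le_freshRate (M := M) (l := ρ.last)
        (D.sum_eq_one ρ s) (E.sum_eq_one ρ s)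
      set m : Act → ℝ≥0 := fun a => min (D.prob ρ s a) (E.prob ρ s a) with hm
      set F := M.freshRate ρ.last (D.prob ρ s) (E.prob ρ s)
      set Em := ∑ a, m a * M.exitRate ρ.last a with hEm
      have hA : (D.exitRate ρ s : ℝ) ≤ Em + F := by exact_mod_cast hbounds.1
      have hB : (E.exitRate ρ s : ℝ) ≤ Em + F := by exact_mod_cast hbounds.2
      have hEmr : (Em : ℝ) = ∑ a, ∑ l', (m a : ℝ) * M.rate ρ.last a l' := by
        rw [hEm]
        push_cast
        simp only [CTMDP.exitRate, NNReal.coe_sum, Finset.mul_sum]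
      have hu1 : ∀ a l', u (ρ.step a s l') s ≤ 1 := fun a l' =>
        hD.reachProbFrom_le_one (π := ρ.step a s l') ⟨hρ, hsρ.1, hsρ.2⟩ ⟨le_rfl, hsρ.2⟩
      -- The jumps of `D` beyond the common part are estimated by `u ≤ 1`, those of `E` below by `v
      -- ≥ 0`.
      have hQD : D.jump u ρ s ≤ ∑ a, ∑ l', (m a : ℝ) * M.rate ρ.last a l' *
          u (ρ.step a s l') s + (D.exitRate ρ s - Em) := by
        rw [hEmr, ← D.sum_real_rates]
        simp only [jump, ← Finset.sum_sub_distrib, ← Finset.sum_add_distrib]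
        refine Finset.sum_le_sum fun a _ => Finset.sum_le_sum fun l' _ => ?_
        have h1 : (m a : ℝ) ≤ D.prob ρ s a := NNReal.coe_le_coe.2 (min_le_left _ _)
        have h2 : (0 : ℝ) ≤ M.rate ρ.last a l' := NNReal.coe_nonneg _
        nlinarith [mul_nonneg (mul_nonneg (sub_nonneg.2 h1) h2) (sub_nonneg.2 (hu1 a l'))]
      have hQE : ∑ a, ∑ l', (m a : ℝ) * M.rate ρ.last a l' * v (ρ.step a s l') s ≤
          E.jump v ρ s := by
        refine Finset.sum_le_sum fun a _ => Finset.sum_le_sum fun l' _ => ?_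
        have h1 : (m a : ℝ) ≤ E.prob ρ s a := NNReal.coe_le_coe.2 (min_le_right _ _)
        have h2 : 0 ≤ v (ρ.step a s l') s := E.reachProbFrom_nonneg _ _
        gcongr
      have hu : u ρ s ≤ 1 := hD.reachProbFrom_le_one hρ hsρ
      have hv : 0 ≤ v ρ s := E.reachProbFrom_nonneg _ _
      have hmr : ∀ a, min (D.prob ρ s a : ℝ) (E.prob ρ s a) = m a := fun a => by simp [hm]
      simp only [hmr, mul_sub, Finset.sum_sub_distrib]
      -- The local terms contribute `(Em + F - e_D) u - (Em + F - e_E) v ≤ Em + F - e_D`, with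
      -- `e_D`, `e_E` the exit rates of `D`, `E`. Adding the excess `e_D - Em` from `hQD` leaves
      -- exactly `F`, the fresh jump term.
      have h1 := mul_nonneg (sub_nonneg.2 hA) (sub_nonneg.2 hu)
      have h2 := mul_nonneg (sub_nonneg.2 hB) hv
      push_cast
      change _ * u ρ s - _ * v ρ s - _ ≤ _
      nlinarith

end Scheduler

end CTMDP

/-! ### Lipschitz estimates for the distance, and passage to the limit. -/

namespace CTMDP

variable {L Act : Type*} [Fintype L] [Fintype Act] {M : CTMDP L Act}

namespace Scheduler

variable {D E : M.Scheduler} {T : ℝ}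

theorem IsCylindrical.exists_cylindricalWith {S : M.Scheduler} (hS : S.IsCylindrical T) :
    ∃ J, S.CylindricalWith T J :=
  let ⟨J, _, _, h⟩ := hS
  ⟨J, h⟩

/-- The union of the two endpoint sets gives a common partition for `D` and `E`. -/
theorem IsCylindrical.reachProb_sub_le (hD : D.IsCylindrical T) (hE : E.IsCylindrical T) (l : L)
    {t : ℝ} (ht : t ∈ Set.Icc 0 T) :
    D.reachProb T l t - E.reachProb T l t ≤ (D.diff E).reachProb T (some l) t := by
  classical
  obtain ⟨J, hJ⟩ := hD.exists_cylindricalWith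
  obtain ⟨J', hJ'⟩ := hE.exists_cylindricalWith
  exact (hJ.mono Finset.subset_union_left).reachGap_le (hJ'.mono Finset.subset_union_right)
    (π := .start (some l)) trivial ht

/-- The distance only sees starts at time `0`. Such a run is still in `l` with a one-location
history at time `t` with probability at least the inverse of the exponential factor. -/
theorem IsCylindrical.diff_reachProb_le (hD : D.IsCylindrical T) (hE : E.IsCylindrical T) (l : L)
    {t : ℝ} (ht : t ∈ Set.Icc 0 T) : (D.diff E).reachProb T (some l) t ≤
      Real.exp (M.diff.totalRate * t) * (D.diff E).reachProb T (some l) 0 := by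
  classical
  obtain ⟨J, hJ⟩ := hD.exists_cylindricalWith
  obtain ⟨J', hJ'⟩ := hE.exists_cylindricalWith
  have h := ((hJ.mono Finset.subset_union_left).diff
    (hJ'.mono Finset.subset_union_right)).reachProbFrom_le_exp_mul
    (π := .start (some l)) trivial (t := 0) ⟨le_rfl, ht.1.trans ht.2⟩ ht
  rwa [sub_zero] at h

theorem distance_eq (D E : M.Scheduler) :
    distance T D E = ∑ l, (M.init l : ℝ) * (D.diff E).reachProb T (some l) 0 := by
  simp [distance, totalReachProb, CTMDP.diff, Fintype.sum_option]

theorem init_mul_le_distance (D E : M.Scheduler) (l : L) :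
    (M.init l : ℝ) * (D.diff E).reachProb T (some l) 0 ≤ distance T D E := by
  rw [distance_eq]
  exact Finset.single_le_sum (f := fun l => (M.init l : ℝ) * (D.diff E).reachProb T (some l) 0)
    (fun l _ => mul_nonneg (NNReal.coe_nonneg _) ((D.diff E).reachProbFrom_nonneg _ _))
    (Finset.mem_univ l)

theorem IsCylindrical.totalReachProb_sub_le (hT : 0 ≤ T) (hD : D.IsCylindrical T)
    (hE : E.IsCylindrical T) : D.totalReachProb T - E.totalReachProb T ≤ distance T D E := by
  rw [distance_eq, totalReachProb, totalReachProb, ← Finset.sum_sub_distrib]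
  refine Finset.sum_le_sum fun l _ => ?_
  rw [← mul_sub]
  exact mul_le_mul_of_nonneg_left (hD.reachProb_sub_le hE l ⟨le_rfl, hT⟩) (NNReal.coe_nonneg _)

end Scheduler

/-- A functional of schedulers that is Lipschitz for the distance converges along a measurable
scheduler. -/
theorem MeasurableScheduler.exists_tendsto {T : ℝ} (S : M.MeasurableScheduler T)
    {F : M.Scheduler → ℝ} {K : ℝ} (hK : 0 < K)
    (hF : ∀ D E : M.Scheduler, D.IsCylindrical T → E.IsCylindrical T →
      F D - F E ≤ K * Scheduler.distance T D E) :
    ∃ p, Tendsto (fun n => F (S.seq n)) atTop (𝓝 p) := by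
  refine cauchySeq_tendsto_of_complete (Metric.cauchySeq_iff.2 fun ε hε => ?_)
  obtain ⟨N, hN⟩ := S.cauchy (ε / K) (div_pos hε hK)
  -- The Cauchy condition concerns indices strictly above `N`. The one-sided estimate suffices, as
  -- `m` and `n` may be exchanged.
  have key : ∀ m ≥ N + 1, ∀ n ≥ N + 1, F (S.seq m) - F (S.seq n) < ε := fun m hm n hn =>
    calc _ ≤ K * Scheduler.distance T (S.seq m) (S.seq n) :=
          hF _ _ (S.cylindrical m) (S.cylindrical n)
      _ < K * (ε / K) := mul_lt_mul_of_pos_left (hN m hm n hn) hK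
      _ = ε := mul_div_cancel₀ _ hK.ne'
  refine ⟨N + 1, fun m hm n hn => ?_⟩
  rw [Real.dist_eq, abs_sub_lt_iff]
  exact ⟨key m hm n hn, key n hn m hm⟩

end CTMDP

theorem lemma1 {L Act : Type*} [Fintype L] [Fintype Act] (M : CTMDP L Act)
    (T : ℝ) (hT : 0 ≤ T) (fmax fmin : L → ℝ → ℝ)
    (hmax : M.IsFMax T fmax) (hmin : M.IsFMin T fmin) (S : M.MeasurableScheduler T) :
    (∀ l, ∀ t ∈ Set.Icc 0 T,
      (0 < M.init l → ∃ p, S.HasReachProb l t p) ∧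
      ∀ p, S.HasReachProb l t p → fmin l t ≤ p ∧ p ≤ fmax l t) ∧
    ∃ p, S.HasTotalReachProb p ∧
      ∑ l, (M.init l : ℝ) * fmin l 0 ≤ p ∧ p ≤ ∑ l, (M.init l : ℝ) * fmax l 0 := by
  have hbounds : ∀ n l, ∀ t ∈ Set.Icc 0 T,
      fmin l t ≤ (S.seq n).reachProb T l t ∧ (S.seq n).reachProb T l t ≤ fmax l t := by
    intro n l t ht
    obtain ⟨J, hJ⟩ := (S.cylindrical n).exists_cylindricalWith
    exact ⟨hJ.fmin_le_reachProb hmin l ht, hJ.reachProb_le_fmax hmax l ht⟩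
  refine ⟨fun l t ht => ⟨fun hl => ?_, fun p hp => ?_⟩, ?_⟩
  · have hl' : (0 : ℝ) < M.init l := NNReal.coe_pos.2 hl
    -- The constant combines the passage from time `t` to time `0` with the weight of `l` in the
    -- distance.
    refine S.exists_tendsto (F := fun D => D.reachProb T l t)
      (K := Real.exp (M.diff.totalRate * t) / M.init l) (div_pos (Real.exp_pos _) hl')
      fun D E hD hE => (hD.reachProb_sub_le hE l ht).trans
        ((hD.diff_reachProb_le hE l ht).trans ?_)
    rw [div_mul_eq_mul_div, mul_div_assoc]
    refine mul_le_mul_of_nonneg_left ?_ (Real.exp_pos _).le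
    rw [le_div_iff₀ hl', mul_comm]
    exact D.init_mul_le_distance E l
  · exact ⟨ge_of_tendsto' hp fun n => (hbounds n l t ht).1,
      le_of_tendsto' hp fun n => (hbounds n l t ht).2⟩
  · obtain ⟨p, hp⟩ := S.exists_tendsto (F := fun D => D.totalReachProb T) one_pos
      fun D E hD hE => by
        rw [one_mul]
        exact hD.totalReachProb_sub_le hT hE
    refine ⟨p, hp, ge_of_tendsto' hp fun n => ?_, le_of_tendsto' hp fun n => ?_⟩
    · exact Finset.sum_le_sum fun l _ => mul_le_mul_of_nonneg_left
        (hbounds n l 0 ⟨le_rfl, hT⟩).1 (NNReal.coe_nonneg _)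
    · exact Finset.sum_le_sum fun l _ => mul_le_mul_of_nonneg_left
        (hbounds n l 0 ⟨le_rfl, hT⟩).2 (NNReal.coe_nonneg _)
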